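/- Let $\mathfrak c=|\mathbb R|$ and equip the real vector space $\mathbb R^{\mathbb R}$ of all functions $\mathbb R\to\mathbb R$ with the topology of pointwise convergence. For $M\subseteq\mathbb R^{\mathbb R}$ and a cardinal $\mu$, say that $M$ is $\mu$-spaceable if $M\cup\{0\}$ contains a pointwise-closed linear subspace of (Hamel) dimension $\mu$, and let $\mathcal L_p(M)$ be the least cardinal $\kappa$ such that $M\cup\{0\}$ contains no pointwise-closed linear subspace of dimension at least $\kappa$. For a topological space $X$, a function $f\colon X\to\mathbb R$ is - Darboux ($\mathrm D$) if $f[Z]$ is connected for every connected $Z\subseteq X$; - almost continuous ($\mathrm{AC}$) if every open subset of $X\times\mathbb R$ containing the graph of $f$ contains the graph of a continuous function $X\to\mathbb R$; - a connectivity function ($\mathrm{Conn}$) if the graph of $f\restriction Z$ is connected for every connected $Z\subseteq X$; - extendable ($\mathrm{Ext}$) if there is a connectivity function $F\colon X\times[0,1]\to\mathbb R$ with $f(x)=F(x,0)$ for all $x\in X$; - peripherally continuous ($\mathrm{PC}$) if for every $x\in X$ and all open $U\ni x$, $V\ni f(x)$ there is an open $W$ with $x\in W\subseteq U$ and $f[\mathrm{bd}(W)]\subseteq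 V$. The domain $X$ is dropped from the notation when $X=\mathbb R$. A perfect set is a nonempty closed subset of $\mathbb R$ without isolated points; a set is between $a$ and $b$ if it is contained in the open interval with endpoints $a,b$ (in either order). A function $f\colon\mathbb R\to\mathbb R$ has - the Cantor intermediate value property ($\mathrm{CIVP}$) if for all $x,y\in\mathbb R$ and every perfect set $K$ between $f(x)$ and $f(y)$ there is a perfect set $C$ between $x$ and $y$ with $f[C]\subseteq K$; - the strong Cantor intermediate value property ($\mathrm{SCIVP}$) if, in addition, $C$ can be chosen so that $f\restriction C$ is continuous; - the weak Cantor intermediate value property ($\mathrm{WCIVP}$) if for all $x,y\in\mathbb R$ with $f(x)<f(y)$ there is a perfect set $C$ between $x$ and $y$ with $f[C]\subseteq(f(x),f(y))$; - perfect roads ($\mathrm{PR}$) if for every $x\in\mathbb R$ there is a perfect set $P$ having $x$ as a two-sided limit point such that $f\restriction P$ is continuous at $x$. **Theorem.** $\mathcal L_p(\mathrm{Ext})=(2^{\mathfrak c})^+$. Moreover, each of the classes $\mathrm{Ext}$, $\mathrm{AC}$, $\mathrm{Conn}$, $\mathrm D$, $\mathrm{SCIVP}$, $\mathrm{CIVP}$,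 $\mathrm{WCIVP}$, $\mathrm{PR}$, $\mathrm{PC}$ is $2^{\mathfrak c}$-spaceable with respect to the topology of pointwise convergence. -/

import Mathlib

open scoped Cardinal

namespace DarbouxLike

section Spaceability

variable (K : Type*) {W : Type*} [Field K] [AddCommGroup W] [Module K W] [TopologicalSpace W]

/-- `M` is `μ`-spaceable (for the topology of `W`): `M ∪ {0}` contains a closed linear subspace
whose dimension (cardinality of a Hamel basis) is `μ`. -/
def IsSpaceable (M : Set W) (μ : Cardinal) : Prop :=
  ∃ V : Submodule K W, IsClosed (V : Set W) ∧ (V : Set W) ⊆ M ∪ {0} ∧ Module.rank K V = μ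

/-- The spaceability cardinal number of `M`: the least cardinal `κ` such that `M ∪ {0}` contains
no closed linear subspace of dimension `κ` or more. Thus it equals `Order.succ μ` exactly when `μ`
is the largest dimension of a closed linear subspace contained in `M ∪ {0}`. -/
noncomputable def spaceabilityNumber (M : Set W) : Cardinal :=
  sInf {κ | ¬ ∃ V : Submodule K W,
    IsClosed (V : Set W) ∧ (V : Set W) ⊆ M ∪ {0} ∧ κ ≤ Module.rank K V}

end Spaceability

section General

variable (X : Type*) [TopologicalSpace X]

/-- Darboux functions: images of connected sets are connected. -/
def Darboux : Set (X → ℝ) :=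
  {f | ∀ Z : Set X, IsConnected Z → IsConnected (f '' Z)}

/-- Almost continuous functions in the sense of Stallings. -/
def AlmostContinuous : Set (X → ℝ) :=
  {f | ∀ G : Set (X × ℝ), IsOpen G → (∀ x, (x, f x) ∈ G) →
    ∃ g : X → ℝ, Continuous g ∧ ∀ x, (x, g x) ∈ G}

/-- Connectivity functions: the graph of the restriction to any connected set is connected. -/
def Connectivity : Set (X → ℝ) :=
  {f | ∀ Z : Set X, IsConnected Z → IsConnected ((fun x => (x, f x)) '' Z)}

/-- Extendable functions: `f x = F (x, 0)` for a connectivity function `F` on `X × [0,1]`. -/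
def Extendable : Set (X → ℝ) :=
  {f | ∃ F ∈ Connectivity (X × unitInterval), ∀ x, f x = F (x, 0)}

/-- Peripherally continuous functions. -/
def PeripherallyContinuous : Set (X → ℝ) :=
  {f | ∀ (x : X) (U : Set X) (V : Set ℝ), IsOpen U → x ∈ U → IsOpen V → f x ∈ V →
    ∃ O : Set X, IsOpen O ∧ O ⊆ U ∧ x ∈ O ∧ f '' frontier O ⊆ V}

end General

/-- Perfect sets of reals: nonempty, closed, without isolated points. -/
def IsPerfectSet (P : Set ℝ) : Prop := P.Nonempty ∧ Perfect P

/-- `S` lies (strictly) between `a` and `b`, in whichever order these come. -/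
def Between (S : Set ℝ) (a b : ℝ) : Prop := S ⊆ Set.Ioo (min a b) (max a b)

/-- Functions with the Cantor intermediate value property. -/
def CIVP : Set (ℝ → ℝ) :=
  {f | ∀ (x y : ℝ) (K : Set ℝ), IsPerfectSet K → Between K (f x) (f y) →
    ∃ C : Set ℝ, IsPerfectSet C ∧ Between C x y ∧ f '' C ⊆ K}

/-- Functions with the strong Cantor intermediate value property. -/
def SCIVP : Set (ℝ → ℝ) :=
  {f | ∀ (x y : ℝ) (K : Set ℝ), IsPerfectSet K → Between K (f x) (f y) →
    ∃ C : Set ℝ, IsPerfectSet C ∧ Between C x y ∧ f '' C ⊆ K ∧ ContinuousOn f C}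

/-- Functions with the weak Cantor intermediate value property. -/
def WCIVP : Set (ℝ → ℝ) :=
  {f | ∀ x y : ℝ, f x < f y →
    ∃ C : Set ℝ, IsPerfectSet C ∧ Between C x y ∧ f '' C ⊆ Set.Ioo (f x) (f y)}

/-- Functions with perfect roads: every `x` is a two-sided limit point of a perfect set `P`
such that the restriction of `f` to `P` is continuous at `x`. -/
def PerfectRoads : Set (ℝ → ℝ) :=
  {f | ∀ x : ℝ, ∃ P : Set ℝ, IsPerfectSet P ∧
    x ∈ closure (P ∩ Set.Iio x) ∧ x ∈ closure (P ∩ Set.Ioi x) ∧ ContinuousWithinAt f P x}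

end DarbouxLike

/-!
A single sort of function gives all the classes. For `x : ℝ` let `osc k x` be the distance from
`2 ^ (k ^ 2) * x` to the nearest integer and `phase x = ∑ osc k x`. The points of finite phase form
a subgroup `finitePhase` of `ℝ`. Fix a continuous `S` that takes every value at arbitrarily large
arguments but varies slowly near infinity (`IsSweeping`).

*Every* function `f` that agrees with `S ∘ phase` on `finitePhase`, with arbitrary values elsewhere,
is extendable. The extension to the strip `ℝ × [0, 1]` is `S` of an interpolation of the partial
phases `partialPhase n x = ∑_{k < n} osc k x`, continuous off the bottom line. Over a grid interval
of scale `n`, that is, of length `2 ^ (-n ^ 2)`, consider the rectangle of height `1 / (n + 1)`. On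
its sides and top the extension equals `S ∘ partialPhase n`, because the later oscillations vanish
at grid points; and `partialPhase n` is nearly constant there. By `exists_scale_near` its `S`-value
is close to `f x` for infinitely many `n`: at points of finite phase by convergence, and at the
others because the partial phases tend to infinity in bounded steps, so that `S` sweeps slowly
through `f x`. Thus every point of the bottom line is enclosed by arbitrarily small arcs on which
the extension is close to `f x`, and `mem_connectivity_of_rims` shows that this suffices for a
connectivity function: given a separation of the graph over a connected set, the maximal
rectangles with a rim on one side of the separation are recoloured, which makes the induced
two-colouring locally constant.

The same approximation, with a bisection argument, gives almost continuity. For the strong Cantor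
intermediate value property, a Darboux argument applied to a modification of `f` off `finitePhase`
shows that `f` takes each value in question on `finitePhase`; so the relevant preimage of a perfect
set is an uncountable Borel set, and it contains a perfect set on which the Borel function
`S ∘ phase` is continuous. The other classes contain one of these.

Finally, `finitePhase` has continuum many cosets, with representatives `cosetRep a`. Prescribing on
each coset an arbitrary multiple `s a` of the translate of `sweep ∘ phase`, and `0` elsewhere,
embeds `ℝ ^ 𝔠` linearly as a pointwise closed subspace. If `s a ≠ 0` for some `a`, then the above
applies to the coset of `a`, whatever the function does off this coset. The dimension is `2 ^ 𝔠`,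
which is also that of the whole space `ℝ → ℝ`.
-/

namespace DarbouxLike

open Filter Topology

/-! ### The phase -/

/-- The frequencies `2 ^ (n ^ 2)`: each divides the next, and the quotients tend to infinity. -/
noncomputable def scale (n : ℕ) : ℝ := 2 ^ (n ^ 2)

/-- The distance from `scale n * x` to the nearest integer. -/
noncomputable def osc (n : ℕ) (x : ℝ) : ℝ := ‖((scale n * x : ℝ) : UnitAddCircle)‖

/-- The phase accumulated by `x` before scale `n`. -/
noncomputable def partialPhase (n : ℕ) (x : ℝ) : ℝ := ∑ k ∈ Finset.range n, osc k x

/-- The additive group of the points whose total phase is finite. -/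
def finitePhase : AddSubgroup ℝ where
  carrier := {x | Summable fun k => osc k x}
  zero_mem' := by simp [osc, summable_zero]
  add_mem' {x y} hx hy := by
    refine Summable.of_nonneg_of_le (fun k => norm_nonneg _) (fun k => ?_) (hx.add hy)
    simpa only [osc, mul_add, AddCircle.coe_add] using norm_add_le _ _
  neg_mem' {x} hx := by
    simpa only [osc, Set.mem_ofPred_eq, mul_neg, AddCircle.coe_neg, norm_neg] using hx

/-- The total phase of a point (`0` if it is infinite). -/
noncomputable def phase (x : ℝ) : ℝ := ∑' k, osc k x

theorem scale_pos (n : ℕ) : 0 < scale n := by unfold scale; positivity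

theorem scale_ne_zero (n : ℕ) : scale n ≠ 0 := (scale_pos n).ne'

theorem add_one_le_scale (n : ℕ) : (n : ℝ) + 1 ≤ scale n := by
  have : n + 1 ≤ 2 ^ (n ^ 2) := Nat.lt_two_pow_self.trans_le
    (Nat.pow_le_pow_right (by norm_num) (Nat.le_self_pow two_ne_zero n))
  rw [scale]
  exact_mod_cast this

theorem exists_scale_eq_mul {n n' : ℕ} (h : n ≤ n') :
    ∃ d : ℤ, 0 < d ∧ scale n' = scale n * d := by
  refine ⟨2 ^ (n' ^ 2 - n ^ 2), by positivity, ?_⟩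
  have : n ^ 2 ≤ n' ^ 2 := Nat.pow_le_pow_left h 2
  push_cast
  rw [scale, scale, ← pow_add, Nat.add_sub_cancel' this]

theorem scale_succ (n : ℕ) : scale (n + 1) = scale n * (2 * 4 ^ n) := by
  have : (4 : ℝ) ^ n = 2 ^ (2 * n) := by rw [pow_mul]; norm_num
  rw [scale, scale, this, ← pow_succ', ← pow_add]
  congr 1
  ring

theorem osc_nonneg (n : ℕ) (x : ℝ) : 0 ≤ osc n x := norm_nonneg _

theorem osc_le_half (n : ℕ) (x : ℝ) : osc n x ≤ 1 / 2 := by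
  simpa [osc] using AddCircle.norm_le_half_period (1 : ℝ) (x := ((scale n * x : ℝ))) one_ne_zero

theorem norm_coe_unitAddCircle_le (x : ℝ) : ‖(x : UnitAddCircle)‖ ≤ |x| := by
  rw [UnitAddCircle.norm_eq]
  simpa using round_le x 0

theorem norm_intCast_unitAddCircle (m : ℤ) : ‖((m : ℝ) : UnitAddCircle)‖ = 0 := by
  rw [UnitAddCircle.norm_eq]
  simp

/-- At a point of the grid of scale `n`, all later oscillations vanish. -/
theorem osc_eq_zero {n k : ℕ} (h : n ≤ k) {x : ℝ} {m : ℤ} (hx : scale n * x = m) :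
    osc k x = 0 := by
  obtain ⟨d, -, hd⟩ := exists_scale_eq_mul h
  have : scale k * x = ((d * m : ℤ) : ℝ) := by
    rw [hd]; push_cast; rw [← hx]; ring
  rw [osc, this, norm_intCast_unitAddCircle]

theorem abs_osc_sub_le (n : ℕ) (x y : ℝ) : |osc n x - osc n y| ≤ scale n * |x - y| := by
  refine (abs_norm_sub_norm_le _ _).trans ?_
  rw [← AddCircle.coe_sub, ← mul_sub]
  refine (norm_coe_unitAddCircle_le _).trans ?_
  rw [abs_mul, abs_of_pos (scale_pos n)]

theorem continuous_osc (n : ℕ) : Continuous (osc n) := by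
  unfold osc
  exact continuous_norm.comp
    ((AddCircle.continuous_mk' 1).comp (continuous_const.mul continuous_id))

theorem sum_scale_le (n : ℕ) : ∑ k ∈ Finset.range n, scale k ≤ scale n := by
  induction n with
  | zero => simpa using (scale_pos 0).le
  | succ n ih =>
    rw [Finset.sum_range_succ, scale_succ]
    have h1 : (1 : ℝ) ≤ 4 ^ n := one_le_pow₀ (by norm_num)
    nlinarith [scale_pos n]

theorem sum_scale_mul_le (n : ℕ) :
    (∑ k ∈ Finset.range (n + 1), scale k) * 4 ^ n ≤ scale (n + 1) := by
  rw [Finset.sum_range_succ, scale_succ]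
  have h1 : (0 : ℝ) < 4 ^ n := by positivity
  nlinarith [sum_scale_le n]

theorem abs_partialPhase_sub_le (n : ℕ) (x y : ℝ) :
    |partialPhase n x - partialPhase n y| ≤ (∑ k ∈ Finset.range n, scale k) * |x - y| := by
  rw [partialPhase, partialPhase, ← Finset.sum_sub_distrib, Finset.sum_mul]
  exact (Finset.abs_sum_le_sum_abs _ _).trans (Finset.sum_le_sum fun k _ => abs_osc_sub_le k x y)

theorem abs_partialPhase_sub_le_one {n : ℕ} {x y : ℝ} (h : scale n * |x - y| ≤ 1) :
    |partialPhase n x - partialPhase n y| ≤ 1 :=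
  (abs_partialPhase_sub_le n x y).trans
    ((mul_le_mul_of_nonneg_right (sum_scale_le n) (abs_nonneg _)).trans h)

/-- Within one grid length of scale `n + 1` the partial phase is nearly constant, since the
frequency `scale (n + 1)` is much larger than the sum of the earlier ones. -/
theorem abs_partialPhase_succ_sub_le {n : ℕ} {x y : ℝ} (h : scale (n + 1) * |x - y| ≤ 1) :
    |partialPhase (n + 1) x - partialPhase (n + 1) y| ≤ (1 / 4) ^ n := by
  refine (abs_partialPhase_sub_le _ x y).trans ?_
  have h1 : (0 : ℝ) < 4 ^ n := by positivity
  rw [one_div, inv_pow, ← one_div, le_div_iff₀ h1]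
  have := mul_le_mul_of_nonneg_right (sum_scale_mul_le n) (abs_nonneg (x - y))
  nlinarith

theorem phase_eq_partialPhase {n : ℕ} {x : ℝ} {m : ℤ} (hx : scale n * x = m) :
    phase x = partialPhase n x :=
  tsum_eq_sum fun k hk => osc_eq_zero (by simpa using hk) hx

theorem mem_finitePhase {x : ℝ} : x ∈ finitePhase ↔ Summable fun k => osc k x := Iff.rfl

theorem mem_finitePhase_of_grid {n : ℕ} {x : ℝ} {m : ℤ} (hx : scale n * x = m) :
    x ∈ finitePhase :=
  summable_of_ne_finset_zero (s := Finset.range n)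
    fun k hk => osc_eq_zero (by simpa using hk) hx

theorem tendsto_partialPhase {x : ℝ} (hx : x ∈ finitePhase) :
    Tendsto (fun n => partialPhase n x) atTop (𝓝 (phase x)) :=
  (mem_finitePhase.1 hx).hasSum.tendsto_sum_nat

theorem tendsto_partialPhase_atTop {x : ℝ} (hx : x ∉ finitePhase) :
    Tendsto (fun n => partialPhase n x) atTop atTop :=
  (not_summable_iff_tendsto_nat_atTop_of_nonneg fun k => osc_nonneg k x).1 hx

/-! ### Sweeping functions -/

/-- A continuous function is sweeping if it varies slowly near infinity and takes every value at
arbitrarily large arguments. -/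
structure IsSweeping (S : ℝ → ℝ) : Prop where
  continuous : Continuous S
  slow : ∀ ε > 0, ∃ M, ∀ p ≥ M, ∀ q ≥ M, |p - q| ≤ 1 → |S p - S q| < ε
  exists_eq : ∀ v M : ℝ, ∃ p ≥ M, S p = v

theorem IsSweeping.const_mul {S : ℝ → ℝ} (hS : IsSweeping S) {c : ℝ} (hc : c ≠ 0) :
    IsSweeping fun p => c * S p where
  continuous := continuous_const.mul hS.continuous
  slow ε hε := by
    obtain ⟨M, hM⟩ := hS.slow (ε / |c|) (div_pos hε (abs_pos.2 hc))
    refine ⟨M, fun p hp q hq hpq => ?_⟩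
    rw [← mul_sub, abs_mul, mul_comm, ← lt_div_iff₀ (abs_pos.2 hc)]
    exact hM p hp q hq hpq
  exists_eq v M := by
    obtain ⟨p, hp, h⟩ := hS.exists_eq (v / c) M
    exact ⟨p, hp, by rw [h, mul_div_cancel₀ _ hc]⟩

/-- An explicit sweeping function. -/
noncomputable def sweep (p : ℝ) : ℝ :=
  (1 + Real.log (1 + |p|)) * Real.cos (Real.log (1 + |p|))

theorem sweep_zero : sweep 0 = 1 := by simp [sweep]

theorem continuous_sweep : Continuous sweep := by
  have : Continuous fun p : ℝ => Real.log (1 + |p|) :=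
    
    (continuous_const.add continuous_abs).log fun p => (by positivity : (0 : ℝ) < 1 + |p|).ne'
  exact (continuous_const.add this).mul (Real.continuous_cos.comp this)

theorem hasDerivWithinAt_sweep {M p : ℝ} (hM : 0 ≤ M) (hp : p ∈ Set.Ici M) :
    HasDerivWithinAt sweep ((Real.cos (Real.log (1 + p)) - (1 + Real.log (1 + p)) *
      Real.sin (Real.log (1 + p))) / (1 + p)) (Set.Ici M) p := by
  have hp0 : 0 ≤ p := hM.trans hp
  have hne : (1 + p) ≠ 0 := by positivity
  have hl : HasDerivAt (fun p : ℝ => Real.log (1 + p)) (1 / (1 + p)) p :=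
    ((hasDerivAt_id p).const_add 1).log hne
  have := (hl.const_add 1).mul hl.cos
  refine (this.congr_deriv ?_).hasDerivWithinAt.congr_of_mem (fun q hq => ?_) hp
  · field_simp
    ring
  · rw [sweep, abs_of_nonneg (hM.trans hq)]
    simp

theorem isSweeping_sweep : IsSweeping sweep where
  continuous := continuous_sweep
  slow ε hε := by
    have hlim : Tendsto (fun p : ℝ => (2 + Real.log (1 + p)) / (1 + p)) atTop (𝓝 0) := by
      have h1 : Tendsto (fun u : ℝ => 2 * u⁻¹ + Real.log u / u) atTop (𝓝 0) := by
        simpa using (tendsto_inv_atTop_zero.const_mul (2 : ℝ)).add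
          Real.isLittleO_log_id_atTop.tendsto_div_nhds_zero
      refine (h1.comp (tendsto_atTop_add_const_left _ 1 tendsto_id)).congr fun p => ?_
      simp only [Function.comp, id]
      ring
    obtain ⟨M, hM⟩ := eventually_atTop.1
      ((hlim.eventually (gt_mem_nhds (half_pos hε))).and (eventually_ge_atTop 0))
    have hM0 : 0 ≤ M := (hM M le_rfl).2
    refine ⟨M, fun p hp q hq hpq => ?_⟩
    have := Convex.norm_image_sub_le_of_norm_hasDerivWithin_le (C := ε / 2)
      (fun x hx => hasDerivWithinAt_sweep hM0 hx) (fun x hx => ?_) (convex_Ici M)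
      (Set.mem_Ici.2 hq) (Set.mem_Ici.2 hp)
    · simp only [Real.norm_eq_abs] at this
      nlinarith
    · have hx0 : 0 ≤ x := hM0.trans hx
      have hlog : 0 ≤ Real.log (1 + x) := Real.log_nonneg (by linarith)
      refine le_trans ?_ (hM x hx).1.le
      rw [Real.norm_eq_abs, abs_div, abs_of_pos (by positivity : 0 < 1 + x)]
      gcongr
      refine (abs_sub _ _).trans ?_
      rw [abs_mul, abs_of_nonneg (by positivity : 0 ≤ 1 + Real.log (1 + x))]
      nlinarith [Real.abs_cos_le_one (Real.log (1 + x)), Real.abs_sin_le_one (Real.log (1 + x))]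
  exists_eq v M := by
    -- `sweep` is `(1 + L) cos L` with `L = log (1 + |p|)`; take `L` a large multiple of `2π`,
    -- respectively half a period later.
    obtain ⟨k, hk⟩ := exists_nat_ge (|v| + |M| + 1)
    have hπ := Real.pi_gt_three
    have hkπ : |v| + |M| + 1 ≤ k * (2 * Real.pi) := by
      nlinarith [abs_nonneg v, abs_nonneg M]
    have key : ∀ L : ℝ, 0 ≤ L → sweep (Real.exp L - 1) = (1 + L) * Real.cos L := fun L hL => by
      rw [sweep, abs_of_nonneg (sub_nonneg.2 (Real.one_le_exp hL)), add_sub_cancel, Real.log_exp]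
    set L₁ : ℝ := k * (2 * Real.pi)
    have hL₁ : 0 ≤ L₁ := by positivity
    have h1 : sweep (Real.exp L₁ - 1) = 1 + L₁ := by
      rw [key L₁ hL₁, Real.cos_nat_mul_two_pi, mul_one]
    have h2 : sweep (Real.exp (L₁ + Real.pi) - 1) = -(1 + (L₁ + Real.pi)) := by
      rw [key _ (by positivity), Real.cos_add_pi, Real.cos_nat_mul_two_pi, mul_neg_one]
    have hle : Real.exp L₁ - 1 ≤ Real.exp (L₁ + Real.pi) - 1 := by
      gcongr
      linarith
    obtain ⟨p, hp, hpv⟩ := intermediate_value_Icc' hle continuous_sweep.continuousOn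
      (show v ∈ Set.Icc _ _ by
        rw [h1, h2]
        constructor <;> nlinarith [abs_le.1 (le_refl |v|), abs_nonneg M])
    refine ⟨p, ?_, hpv⟩
    have := Real.add_one_le_exp L₁
    linarith [hp.1, le_abs_self M, abs_nonneg v]

/-! ### Prescribed values on the points of finite phase -/

/-- The key approximation. Let `f x = S (phase x)` at the points of finite phase; elsewhere `f` is
arbitrary. At every point there are arbitrarily fine scales at which `S ∘ partialPhase` is close to
`f x`: where the phase is infinite, this is because the partial phases tend to infinity slowly, so
that they sweep over a neighbourhood of a solution of `S p = f x`. -/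
theorem exists_scale_near {S : ℝ → ℝ} (hS : IsSweeping S) {f : ℝ → ℝ}
    (hf : ∀ x ∈ finitePhase, f x = S (phase x)) (x : ℝ) {ε : ℝ} (hε : 0 < ε) (N : ℕ) :
    ∃ n ≥ N, ∀ y, scale n * |y - x| ≤ 1 → |S (partialPhase n y) - f x| < ε := by
  by_cases hx : x ∈ finitePhase
  · obtain ⟨δ, hδ, hSδ⟩ := Metric.continuous_iff.1 hS.continuous (phase x) ε hε
    have h1 := Metric.tendsto_atTop.1 (tendsto_partialPhase hx) (δ / 2) (half_pos hδ)
    have h2 := (tendsto_pow_atTop_nhds_zero_of_lt_one (r := (1 / 4 : ℝ)) (by norm_num)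
      (by norm_num)).eventually (gt_mem_nhds (half_pos hδ))
    obtain ⟨N₁, hN₁⟩ := h1
    obtain ⟨N₂, hN₂⟩ := eventually_atTop.1 h2
    refine ⟨max N (max N₁ N₂) + 1, by omega, fun y hy => ?_⟩
    rw [hf x hx, ← Real.dist_eq]
    apply hSδ
    have h3 := hN₁ (max N (max N₁ N₂) + 1) (by omega)
    have h4 := hN₂ (max N (max N₁ N₂)) (by omega)
    have h5 := abs_partialPhase_succ_sub_le hy
    rw [← Real.dist_eq] at h5
    linarith [dist_triangle (partialPhase (max N (max N₁ N₂) + 1) y)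
      (partialPhase (max N (max N₁ N₂) + 1) x) (phase x)]
  · obtain ⟨M, hM⟩ := hS.slow (ε / 2) (half_pos hε)
    obtain ⟨p, hp, hpv⟩ := hS.exists_eq (f x) (max (M + 1) (partialPhase N x) + 1)
    have hex : ∃ n, p < partialPhase n x :=
      ((tendsto_partialPhase_atTop hx).eventually_gt_atTop p).exists
    have hmono : Monotone fun n => partialPhase n x := monotone_nat_of_le_succ fun n => by
      simpa [partialPhase, Finset.sum_range_succ] using osc_nonneg n x
    classical
    have hn := Nat.find_spec hex
    have hNn : N < Nat.find hex := by
      by_contra h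
      have := hmono (not_lt.1 h)
      simp only at this
      linarith [le_max_right (M + 1) (partialPhase N x)]
    obtain ⟨n, hn'⟩ : ∃ n, Nat.find hex = n + 1 := ⟨Nat.find hex - 1, by omega⟩
    have hmin : partialPhase n x ≤ p := not_lt.1 (Nat.find_min hex (by omega))
    rw [hn'] at hn hNn
    refine ⟨n + 1, hNn.le, fun y hy => ?_⟩
    have h1 : partialPhase (n + 1) x ≤ p + 1 / 2 := by
      have := osc_le_half n x
      rw [partialPhase, Finset.sum_range_succ, ← partialPhase]
      linarith
    have h2 := abs_le.1 (abs_partialPhase_sub_le_one hy)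
    have hMp := le_max_left (M + 1) (partialPhase N x)
    have h3 := hM (partialPhase (n + 1) y) (by linarith) (partialPhase (n + 1) x) (by linarith)
      (abs_partialPhase_sub_le_one hy)
    have h4 := hM (partialPhase (n + 1) x) (by linarith) p (by linarith)
      (abs_le.2 ⟨by linarith, by linarith⟩)
    rw [hpv] at h4
    have h5 := abs_sub_le (S (partialPhase (n + 1) y)) (S (partialPhase (n + 1) x)) (f x)
    linarith

/-! ### Cells and a criterion for connectivity functions -/

/-- The closed rectangle over the `m`-th grid interval of scale `n`, of height `1 / (n + 1)`. -/
def cell (n : ℕ) (m : ℤ) : Set (ℝ × unitInterval) :=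
  {z | (m : ℝ) ≤ scale n * z.1 ∧ scale n * z.1 ≤ m + 1 ∧ (z.2 : ℝ) ≤ 1 / (n + 1)}

/-- The vertical sides and the top of a cell. -/
def rim (n : ℕ) (m : ℤ) : Set (ℝ × unitInterval) :=
  {z | z ∈ cell n m ∧
    (scale n * z.1 = m ∨ scale n * z.1 = m + 1 ∨ (z.2 : ℝ) = 1 / (n + 1))}

theorem height_antitone {n n' : ℕ} (h : n ≤ n') : (1 : ℝ) / (n' + 1) ≤ 1 / (n + 1) := by
  gcongr

theorem abs_sub_le_one_of_mem_cell {n : ℕ} {m : ℤ} {z w : ℝ × unitInterval}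
    (hz : z ∈ cell n m) (hw : w ∈ cell n m) : scale n * |z.1 - w.1| ≤ 1 := by
  rw [← abs_of_pos (scale_pos n), ← abs_mul, mul_sub, abs_le]
  constructor <;> linarith [hz.1, hz.2.1, hw.1, hw.2.1]

theorem rim_nonempty (n : ℕ) (m : ℤ) : (rim n m).Nonempty := by
  have : scale n * (m / scale n) = m := mul_div_cancel₀ _ (scale_ne_zero n)
  refine ⟨(m / scale n, 0), ⟨this.ge, ?_, ?_⟩, Or.inl this⟩
  · simp only [this]; linarith
  · simp only [Set.Icc.coe_zero]; positivity

/-- Two cells are nested unless they meet only along their sides. -/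
theorem cell_subset_or_mem_rim {n n' : ℕ} {m m' : ℤ} (h : n ≤ n') {z : ℝ × unitInterval}
    (hz : z ∈ cell n m) (hz' : z ∈ cell n' m') :
    cell n' m' ⊆ cell n m ∨ (z ∈ rim n m ∧ z ∈ rim n' m') := by
  obtain ⟨d, hd, hs⟩ := exists_scale_eq_mul h
  have hd0 : (0 : ℝ) < d := by exact_mod_cast hd
  have hsz : ∀ x : ℝ, scale n' * x = scale n * x * d := fun x => by rw [hs]; ring
  have hz1 := hz.1
  have hz2 := hz.2.1
  have hz1' := hz'.1
  have hz2' := hz'.2.1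
  rw [hsz] at hz1' hz2'
  by_cases hl : m' + 1 ≤ m * d
  · have hl' : (m' : ℝ) + 1 ≤ m * d := by exact_mod_cast hl
    have e : scale n * z.1 = m := by
      refine le_antisymm (le_of_mul_le_mul_right ?_ hd0) hz1
      linarith
    refine Or.inr ⟨⟨hz, Or.inl e⟩, hz', Or.inr (Or.inl ?_)⟩
    rw [e] at hz2'
    rw [hsz, e]
    linarith
  by_cases hr : (m + 1) * d ≤ m'
  · have hr' : ((m : ℝ) + 1) * d ≤ m' := by exact_mod_cast hr
    have e : scale n * z.1 = m + 1 := by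
      refine le_antisymm hz2 (le_of_mul_le_mul_right ?_ hd0)
      linarith
    refine Or.inr ⟨⟨hz, Or.inr (Or.inl e)⟩, hz', Or.inl ?_⟩
    rw [e] at hz1'
    rw [hsz, e]
    linarith
  · left
    have hl' : (m : ℝ) * d ≤ m' := by exact_mod_cast (by omega : m * d ≤ m')
    have hr' : (m' : ℝ) + 1 ≤ (m + 1) * d := by exact_mod_cast (by omega : m' + 1 ≤ (m + 1) * d)
    rintro w ⟨h1, h2, h3⟩
    rw [hsz] at h1 h2
    exact ⟨le_of_mul_le_mul_right (hl'.trans h1) hd0, le_of_mul_le_mul_right (h2.trans hr') hd0,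
      h3.trans (height_antitone h)⟩

theorem cell_subset_or_mem_rim' {n n' : ℕ} {m m' : ℤ} {z : ℝ × unitInterval}
    (hz : z ∈ cell n m) (hz' : z ∈ cell n' m') :
    (n ≤ n' ∧ cell n' m' ⊆ cell n m) ∨ (n' ≤ n ∧ cell n m ⊆ cell n' m') ∨
      (z ∈ rim n m ∧ z ∈ rim n' m') := by
  rcases le_total n n' with h | h
  · rcases cell_subset_or_mem_rim h hz hz' with h1 | h1
    · exact Or.inl ⟨h, h1⟩
    · exact Or.inr (Or.inr h1)
  · rcases cell_subset_or_mem_rim h hz' hz with h1 | h1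
    · exact Or.inr (Or.inl ⟨h, h1⟩)
    · exact Or.inr (Or.inr h1.symm)

/-- At a given scale, a point close to `z` lies only in cells that contain `z`. -/
theorem eventually_mem_cell (n : ℕ) (z : ℝ × unitInterval) :
    ∀ᶠ w in 𝓝 z, ∀ m, w ∈ cell n m → z ∈ cell n m := by
  have hc : Continuous fun w : ℝ × unitInterval => scale n * w.1 :=
    continuous_const.mul continuous_fst
  have hc2 : Continuous fun w : ℝ × unitInterval => (w.2 : ℝ) :=
    continuous_subtype_val.comp continuous_snd
  have h1 : ∀ᶠ w in 𝓝 z, scale n * w.1 < ⌊scale n * z.1⌋ + 1 :=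
    hc.continuousAt.eventually (gt_mem_nhds (Int.lt_floor_add_one _))
  have h2 : ∀ᶠ w in 𝓝 z, (⌈scale n * z.1⌉ : ℝ) - 1 < scale n * w.1 :=
    hc.continuousAt.eventually (lt_mem_nhds (by linarith [Int.ceil_lt_add_one (scale n * z.1)]))
  have h3 : ∀ᶠ w in 𝓝 z, (w.2 : ℝ) ≤ 1 / (n + 1) → (z.2 : ℝ) ≤ 1 / (n + 1) := by
    by_cases h : (z.2 : ℝ) ≤ 1 / (n + 1)
    · exact Eventually.of_forall fun _ _ => h
    · filter_upwards [hc2.continuousAt.eventually (lt_mem_nhds (not_le.1 h))] with w hw hw'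
      exact absurd hw' (not_le.2 hw)
  filter_upwards [h1, h2, h3] with w h1 h2 h3 m hm
  refine ⟨?_, ?_, h3 hm.2.2⟩
  · have : (m : ℝ) < ((⌊scale n * z.1⌋ + 1 : ℤ) : ℝ) := by push_cast; linarith [hm.1]
    exact Int.le_floor.1 (Int.lt_add_one_iff.1 (by exact_mod_cast this))
  · have : ((⌈scale n * z.1⌉ - 1 : ℤ) : ℝ) < ((m + 1 : ℤ) : ℝ) := by push_cast; linarith [hm.2.1]
    have h4 : ⌈scale n * z.1⌉ ≤ m + 1 := by
      have : ⌈scale n * z.1⌉ - 1 < m + 1 := by exact_mod_cast this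
      omega
    exact_mod_cast Int.ceil_le.1 h4

/-- A point of positive height lies in no cell of a sufficiently fine scale, and neither do the
points close to it. -/
theorem eventually_notMem_cell {z : ℝ × unitInterval} (hz : 0 < (z.2 : ℝ)) :
    ∃ N, ∀ᶠ w in 𝓝 z, ∀ n ≥ N, ∀ m, w ∉ cell n m := by
  obtain ⟨N, hN⟩ := exists_nat_one_div_lt hz
  have hc2 : Continuous fun w : ℝ × unitInterval => (w.2 : ℝ) :=
    continuous_subtype_val.comp continuous_snd
  refine ⟨N, ?_⟩
  filter_upwards [hc2.continuousAt.eventually (lt_mem_nhds hN)] with w hw n hn m hm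
  exact absurd (hm.2.2.trans (height_antitone hn)) (not_le.2 hw)

theorem eventually_forall_mem_cell {z : ℝ × unitInterval} (hz : 0 < (z.2 : ℝ)) :
    ∀ᶠ w in 𝓝 z, ∀ n m, w ∈ cell n m → z ∈ cell n m := by
  obtain ⟨N, hN⟩ := eventually_notMem_cell hz
  have h : ∀ᶠ w in 𝓝 z, ∀ n ∈ Finset.range N, ∀ m, w ∈ cell n m → z ∈ cell n m :=
    (Finset.eventually_all _).2 fun n _ => eventually_mem_cell n z
  filter_upwards [hN, h] with w hN h n m hw
  by_cases hn : n < N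
  · exact h n (Finset.mem_range.2 hn) m hw
  · exact absurd hw (hN n (not_lt.1 hn) m)

theorem cell_mem_nhds {n : ℕ} {m : ℤ} {z : ℝ × unitInterval} (hz : z ∈ cell n m)
    (hz' : z ∉ rim n m) : cell n m ∈ 𝓝 z := by
  have hc : Continuous fun w : ℝ × unitInterval => scale n * w.1 :=
    continuous_const.mul continuous_fst
  have hc2 : Continuous fun w : ℝ × unitInterval => (w.2 : ℝ) :=
    continuous_subtype_val.comp continuous_snd
  have hne : ¬ (scale n * z.1 = m ∨ scale n * z.1 = m + 1 ∨ (z.2 : ℝ) = 1 / (n + 1)) :=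
    fun h => hz' ⟨hz, h⟩
  push Not at hne
  filter_upwards [hc.continuousAt.eventually (lt_mem_nhds (lt_of_le_of_ne hz.1 hne.1.symm)),
    hc.continuousAt.eventually (gt_mem_nhds (lt_of_le_of_ne hz.2.1 hne.2.1)),
    hc2.continuousAt.eventually (gt_mem_nhds (lt_of_le_of_ne hz.2.2 hne.2.2))] with w h1 h2 h3
  exact ⟨h1.le, h2.le, h3.le⟩

/-- The cells of scale `n` cover a neighbourhood of the bottom line. -/
theorem eventually_exists_mem_cell (n : ℕ) (x : ℝ) :
    ∀ᶠ w in 𝓝 ((x, 0) : ℝ × unitInterval), ∃ m, w ∈ cell n m ∧ (x, 0) ∈ cell n m := by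
  have hc2 : Continuous fun w : ℝ × unitInterval => (w.2 : ℝ) :=
    continuous_subtype_val.comp continuous_snd
  have h0 : (((x, 0) : ℝ × unitInterval).2 : ℝ) < 1 / (n + 1) := by
    simp only [Set.Icc.coe_zero]; positivity
  filter_upwards [eventually_mem_cell n (x, 0), hc2.continuousAt.eventually (gt_mem_nhds h0)]
    with w h1 h2
  have : w ∈ cell n ⌊scale n * w.1⌋ :=
    ⟨Int.floor_le _, (Int.lt_floor_add_one _).le, h2.le⟩
  exact ⟨_, this, h1 _ this⟩

/-- A cell of scale at least `n₀` is good, of colour `s`, if its rim has colour `s`. -/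
def IsGood (P : Bool → Set (ℝ × unitInterval)) (n₀ : ℕ) (s : Bool) (n : ℕ) (m : ℤ) : Prop :=
  n₀ ≤ n ∧ rim n m ⊆ P s

/-- A good cell that is contained in no good cell of a coarser scale. -/
def IsMaxGood (P : Bool → Set (ℝ × unitInterval)) (n₀ : ℕ) (s : Bool) (n : ℕ) (m : ℤ) : Prop :=
  IsGood P n₀ s n m ∧ ∀ s' n' m', IsGood P n₀ s' n' m' → n' < n → ¬ cell n m ⊆ cell n' m'

/-- The colouring `P` changed on the maximal good cells, each of which gets the colour of its
rim. -/
def recolour (P : Bool → Set (ℝ × unitInterval)) (n₀ : ℕ) (s : Bool) : Set (ℝ × unitInterval) :=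
  {z | (∃ n m, IsMaxGood P n₀ s n m ∧ z ∈ cell n m) ∨
    (z ∈ P s ∧ ∀ s' n m, IsMaxGood P n₀ s' n m → z ∉ cell n m)}

section Recolour

variable {P : Bool → Set (ℝ × unitInterval)} {n₀ : ℕ}

theorem IsGood.exists_isMaxGood {s : Bool} {n : ℕ} {m : ℤ} (h : IsGood P n₀ s n m) :
    ∃ s' n' m', IsMaxGood P n₀ s' n' m' ∧ cell n m ⊆ cell n' m' := by
  induction n using Nat.strong_induction_on generalizing s m with
  | _ n ih =>
    by_cases hmax : IsMaxGood P n₀ s n m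
    · exact ⟨s, n, m, hmax, subset_rfl⟩
    · simp only [IsMaxGood, h, true_and] at hmax
      push Not at hmax
      obtain ⟨s', n', m', hg, hn, hsub⟩ := hmax
      obtain ⟨s'', n'', m'', hm, hsub'⟩ := ih n' hn hg
      exact ⟨s'', n'', m'', hm, hsub.trans hsub'⟩

/-- Overlapping maximal good cells have the same colour: by maximality they are equal or meet only
along their rims. -/
theorem IsMaxGood.colour_eq (hP : ∀ s s' z, z ∈ P s → z ∈ P s' → s = s') {s s' : Bool}
    {n n' : ℕ} {m m' : ℤ} (h : IsMaxGood P n₀ s n m) (h' : IsMaxGood P n₀ s' n' m')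
    {z : ℝ × unitInterval} (hz : z ∈ cell n m) (hz' : z ∈ cell n' m') : s = s' := by
  -- It suffices to find a common point of the two rims.
  suffices ∃ w, w ∈ rim n m ∧ w ∈ rim n' m' by
    obtain ⟨w, hw, hw'⟩ := this
    exact hP s s' w (h.1.2 hw) (h'.1.2 hw')
  by_cases hr : z ∈ rim n m ∧ z ∈ rim n' m'
  · exact ⟨z, hr⟩
  have hn : n = n' := by
    rcases cell_subset_or_mem_rim' hz hz' with ⟨hn, hs⟩ | ⟨hn, hs⟩ | hc
    · exact hn.eq_or_lt.resolve_right fun hlt => h'.2 s n m h.1 hlt hs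
    · exact (hn.eq_or_lt.resolve_right fun hlt => h.2 s' n' m' h'.1 hlt hs).symm
    · exact absurd hc hr
  subst hn
  by_cases hm : m = m'
  · subst hm
    obtain ⟨w, hw⟩ := rim_nonempty n m
    exact ⟨w, hw, hw⟩
  · refine ⟨z, ?_⟩
    rcases lt_or_gt_of_ne hm with hlt | hlt
    · have h1 : (m : ℝ) + 1 ≤ m' := by exact_mod_cast hlt
      exact ⟨⟨hz, Or.inr (Or.inl (by linarith [hz.2.1, hz'.1]))⟩,
        hz', Or.inl (by linarith [hz.2.1, hz'.1])⟩
    · have h1 : (m' : ℝ) + 1 ≤ m := by exact_mod_cast hlt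
      exact ⟨⟨hz, Or.inl (by linarith [hz.1, hz'.2.1])⟩,
        hz', Or.inr (Or.inl (by linarith [hz.1, hz'.2.1]))⟩

theorem recolour_colour_eq (hP : ∀ s s' z, z ∈ P s → z ∈ P s' → s = s') {s s' : Bool}
    {z : ℝ × unitInterval} (hz : z ∈ recolour P n₀ s) (hz' : z ∈ recolour P n₀ s') : s = s' := by
  rcases hz with ⟨n, m, h, hz⟩ | ⟨hz, h⟩ <;> rcases hz' with ⟨n', m', h', hz'⟩ | ⟨hz', h'⟩
  · exact h.colour_eq hP h' hz hz'
  · exact absurd hz (h' _ _ _ h)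
  · exact absurd hz' (h _ _ _ h')
  · exact hP _ _ _ hz hz'

theorem exists_mem_recolour {s : Bool} {z : ℝ × unitInterval} (hz : z ∈ P s) :
    ∃ s', z ∈ recolour P n₀ s' := by
  by_cases h : ∃ s' n m, IsMaxGood P n₀ s' n m ∧ z ∈ cell n m
  · obtain ⟨s', n, m, h, hz'⟩ := h
    exact ⟨s', Or.inl ⟨n, m, h, hz'⟩⟩
  · push Not at h
    exact ⟨s, Or.inr ⟨hz, h⟩⟩

theorem mem_recolour_of_mem_rim (hP : ∀ s s' z, z ∈ P s → z ∈ P s' → s = s') {s : Bool}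
    {z : ℝ × unitInterval} (hz : z ∈ P s) (h : ∀ n ≥ n₀, ∀ m, z ∈ cell n m → z ∈ rim n m) :
    z ∈ recolour P n₀ s := by
  by_cases h' : ∃ s' n m, IsMaxGood P n₀ s' n m ∧ z ∈ cell n m
  · obtain ⟨s', n, m, hm, hz'⟩ := h'
    obtain rfl := hP s s' z hz (hm.1.2 (h n hm.1.1 m hz'))
    exact Or.inl ⟨n, m, hm, hz'⟩
  · push Not at h'
    exact Or.inr ⟨hz, h'⟩

theorem recolour_mem_nhds_of_pos (hP : ∀ s s' z, z ∈ P s → z ∈ P s' → s = s')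
    (hopen : ∀ s z, 0 < (z.2 : ℝ) → z ∈ P s → P s ∈ 𝓝 z) {s : Bool} {z : ℝ × unitInterval}
    (hpos : 0 < (z.2 : ℝ)) (hz : z ∈ recolour P n₀ s) : recolour P n₀ s ∈ 𝓝 z := by
  have hloc := eventually_forall_mem_cell hpos
  rcases hz with ⟨n, m, h, hz⟩ | ⟨hz, h⟩
  · by_cases hr : z ∈ rim n m
    · filter_upwards [hloc, hopen s z hpos (h.1.2 hr)] with w hw hPw
      by_cases hm : ∃ s' n' m', IsMaxGood P n₀ s' n' m' ∧ w ∈ cell n' m'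
      · obtain ⟨s', n', m', hm, hw'⟩ := hm
        obtain rfl := h.colour_eq hP hm hz (hw _ _ hw')
        exact Or.inl ⟨n', m', hm, hw'⟩
      · push Not at hm
        exact Or.inr ⟨hPw, hm⟩
    · filter_upwards [cell_mem_nhds hz hr] with w hw
      exact Or.inl ⟨n, m, h, hw⟩
  · filter_upwards [hloc, hopen s z hpos hz] with w hw hPw
    exact Or.inr ⟨hPw, fun s' n m hm hw' => h s' n m hm (hw _ _ hw')⟩

/-- At the bottom line the recolouring is locally constant, since the good cells at a point of the
line cover a neighbourhood of it and lie in maximal good cells that contain the point. -/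
theorem recolour_mem_nhds_of_good (hP : ∀ s s' z, z ∈ P s → z ∈ P s' → s = s') {s t : Bool}
    {x : ℝ} {n : ℕ} (hn : n₀ ≤ n) (hgood : ∀ m, (x, 0) ∈ cell n m → rim n m ⊆ P t)
    (hz : (x, 0) ∈ recolour P n₀ s) : recolour P n₀ s ∈ 𝓝 (x, 0) := by
  filter_upwards [eventually_exists_mem_cell n x] with w hw
  obtain ⟨m, hwm, hxm⟩ := hw
  obtain ⟨s', n', m', hmax, hsub⟩ :=
    IsGood.exists_isMaxGood (P := P) (n₀ := n₀) ⟨hn, hgood m hxm⟩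
  obtain rfl : s' = s := recolour_colour_eq hP (Or.inl ⟨n', m', hmax, hsub hxm⟩) hz
  exact Or.inl ⟨n', m', hmax, hsub hwm⟩

end Recolour

theorem mem_rim_of_grid {n n' : ℕ} (h : n ≤ n') {z : ℝ × unitInterval} {k m : ℤ}
    (hk : scale n * z.1 = k) (hz : z ∈ cell n' m) : z ∈ rim n' m := by
  obtain ⟨d, -, hs⟩ := exists_scale_eq_mul h
  have e : scale n' * z.1 = ((d * k : ℤ) : ℝ) := by rw [hs]; push_cast; rw [← hk]; ring
  have h1 := hz.1
  have h2 := hz.2.1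
  rw [e] at h1 h2
  have h1' : m ≤ d * k := by exact_mod_cast h1
  have h2' : d * k ≤ m + 1 := by exact_mod_cast h2
  refine ⟨hz, ?_⟩
  rw [e]
  rcases h1'.eq_or_lt with h3 | h3
  · exact Or.inl (by rw [h3])
  · right; left
    have : d * k = m + 1 := by omega
    rw [this]; push_cast; ring

/-- A connected set with at least two points that meets the bottom line at `(x, 0)` also meets the
rim of a cell at `x` of every sufficiently fine scale. -/
theorem exists_mem_rim {Z : Set (ℝ × unitInterval)} (hZ : IsPreconnected Z) {x : ℝ}
    (hx : (x, 0) ∈ Z) {b : ℝ × unitInterval} (hb : b ∈ Z) (hne : b ≠ (x, 0)) :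
    ∃ N, ∀ n ≥ N, ∃ m, (x, 0) ∈ cell n m ∧ (Z ∩ rim n m).Nonempty := by
  -- At fine scales, `b` lies in no cell that contains `(x, 0)`.
  have hN : ∃ N, ∀ n ≥ N, ∀ m, (x, 0) ∈ cell n m → b ∉ cell n m := by
    by_cases hb2 : 0 < (b.2 : ℝ)
    · obtain ⟨N, hN⟩ := eventually_notMem_cell hb2
      exact ⟨N, fun n hn m _ => hN.self_of_nhds n hn m⟩
    · have hb0 : b.2 = 0 := Subtype.ext (le_antisymm (not_lt.1 hb2) b.2.2.1)
      have hbx : b.1 ≠ x := fun h => hne (Prod.ext h hb0)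
      obtain ⟨N, hN⟩ := exists_nat_gt (1 / |b.1 - x|)
      refine ⟨N, fun n hn m hxm hbm => ?_⟩
      have hpos : 0 < |b.1 - x| := abs_pos.2 (sub_ne_zero.2 hbx)
      have h1 := add_one_le_scale n
      have h2 := abs_sub_le_one_of_mem_cell hbm hxm
      have h3 : (N : ℝ) ≤ n := by exact_mod_cast hn
      rw [div_lt_iff₀ hpos] at hN
      nlinarith
  obtain ⟨N, hN⟩ := hN
  refine ⟨N, fun n hn => ?_⟩
  by_contra hcon
  push Not at hcon
  -- Otherwise the union `D` of the cells of scale `n` at `x` has a relatively clopen trace on `Z`.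
  let D : Set (ℝ × unitInterval) := {w | ∃ m, (x, 0) ∈ cell n m ∧ w ∈ cell n m}
  have hnhds : ∀ w ∈ Z ∩ D, D ∈ 𝓝 w := by
    rintro w ⟨hwZ, m, hxm, hwm⟩
    refine mem_of_superset (cell_mem_nhds hwm fun hr => ?_) fun v hv => ⟨m, hxm, hv⟩
    exact (hcon m hxm).le ⟨hwZ, hr⟩
  have hclosed : ∀ w ∉ D, Dᶜ ∈ 𝓝 w := fun w hw => by
    filter_upwards [eventually_mem_cell n w] with v hv hvD
    obtain ⟨m, hxm, hvm⟩ := hvD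
    exact hw ⟨m, hxm, hv m hvm⟩
  have hxD : (x, 0) ∈ D := by
    obtain ⟨m, h1, -⟩ := (eventually_exists_mem_cell n x).self_of_nhds
    exact ⟨m, h1, h1⟩
  have hbD : b ∉ D := fun ⟨m, hxm, hbm⟩ => hN n hn m hxm hbm
  obtain ⟨w, -, hw1, hw2⟩ := hZ (interior D) (interior Dᶜ) isOpen_interior isOpen_interior
    (fun w hw => by
      by_cases h : w ∈ D
      · exact Or.inl (mem_interior_iff_mem_nhds.2 (hnhds w ⟨hw, h⟩))
      · exact Or.inr (mem_interior_iff_mem_nhds.2 (hclosed w h)))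
    ⟨_, hx, mem_interior_iff_mem_nhds.2 (hnhds _ ⟨hx, hxD⟩)⟩
    ⟨_, hb, mem_interior_iff_mem_nhds.2 (hclosed _ hbD)⟩
  exact interior_subset hw2 (interior_subset hw1)

/-- A colouring with two colours of a connected set `Z` that is open at the points of positive
height, and for which every point of `Z` on the bottom line is surrounded by rims of its colour at
arbitrarily fine scales, is constant: recolouring the maximal good cells makes it locally
constant. -/
theorem not_two_coloured {P : Bool → Set (ℝ × unitInterval)} {Z : Set (ℝ × unitInterval)}
    (hZ : IsPreconnected Z) (hP : ∀ s s' z, z ∈ P s → z ∈ P s' → s = s')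
    (hopen : ∀ s z, 0 < (z.2 : ℝ) → z ∈ P s → P s ∈ 𝓝 z)
    (hbot : ∀ s x, (x, 0) ∈ Z → (x, 0) ∈ P s →
      ∀ N, ∃ n ≥ N, ∀ m, (x, 0) ∈ cell n m → rim n m ⊆ P s)
    (hcov : ∀ z ∈ Z, ∃ s, z ∈ P s) (hne : ∀ s, (Z ∩ P s).Nonempty) : False := by
  -- Some point of each colour keeps its colour.
  have hkeep : ∀ s, ∃ N, ∃ z ∈ Z, ∀ n₀ ≥ N, z ∈ recolour P n₀ s := by
    intro s
    obtain ⟨a, haZ, haP⟩ := hne s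
    have hpos : ∀ w ∈ Z, w ∈ P s → 0 < (w.2 : ℝ) →
        ∃ N, ∃ z ∈ Z, ∀ n₀ ≥ N, z ∈ recolour P n₀ s := by
      intro w hwZ hwP hw
      obtain ⟨N, hN⟩ := eventually_notMem_cell hw
      exact ⟨N, w, hwZ, fun n₀ hn₀ => mem_recolour_of_mem_rim hP hwP fun n hn m hm =>
        absurd hm (hN.self_of_nhds n (hn₀.trans hn) m)⟩
    by_cases ha : 0 < (a.2 : ℝ)
    · exact hpos a haZ haP ha
    obtain ⟨x, y⟩ := a
    obtain rfl : y = 0 := Subtype.ext (le_antisymm (not_lt.1 ha) y.2.1)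
    obtain ⟨b, hbZ, hbP⟩ := hne (!s)
    have hba : b ≠ (x, 0) := by
      rintro rfl
      have := hP _ _ _ haP hbP
      cases s <;> simp at this
    obtain ⟨N, hN⟩ := exists_mem_rim hZ haZ hbZ hba
    obtain ⟨n, hn, hgood⟩ := hbot s x haZ haP N
    obtain ⟨m, hxm, w, hwZ, hwr⟩ := hN n hn
    have hwP := hgood m hxm hwr
    by_cases hw : 0 < (w.2 : ℝ)
    · exact hpos w hwZ hwP hw
    have hgrid : ∃ k : ℤ, scale n * w.1 = k := by
      rcases hwr.2 with h | h | h
      · exact ⟨m, h⟩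
      · exact ⟨m + 1, by rw [h]; push_cast; ring⟩
      · refine absurd ?_ hw
        rw [h]; positivity
    obtain ⟨k, hk⟩ := hgrid
    exact ⟨n, w, hwZ, fun n₀ hn₀ => mem_recolour_of_mem_rim hP hwP fun n' hn' m' hm' =>
      mem_rim_of_grid (hn₀.trans hn') hk hm'⟩
  choose N z hzZ hz using hkeep
  set n₀ := max (N true) (N false)
  have hnhds : ∀ s, ∀ w ∈ Z, w ∈ recolour P n₀ s → recolour P n₀ s ∈ 𝓝 w := by
    intro s w hwZ hw
    by_cases hpos : 0 < (w.2 : ℝ)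
    · exact recolour_mem_nhds_of_pos hP hopen hpos hw
    obtain ⟨x, y⟩ := w
    obtain rfl : y = 0 := Subtype.ext (le_antisymm (not_lt.1 hpos) y.2.1)
    obtain ⟨t, ht⟩ := hcov _ hwZ
    obtain ⟨n, hn, hgood⟩ := hbot t x hwZ ht n₀
    exact recolour_mem_nhds_of_good hP hn hgood hw
  have key := hZ (interior (recolour P n₀ true)) (interior (recolour P n₀ false))
    isOpen_interior isOpen_interior
    (fun w hw => by
      obtain ⟨s, hs⟩ := hcov w hw
      obtain ⟨t, ht⟩ := exists_mem_recolour (n₀ := n₀) hs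
      have := mem_interior_iff_mem_nhds.2 (hnhds t w hw ht)
      cases t
      · exact Or.inr this
      · exact Or.inl this)
    ⟨_, hzZ true, mem_interior_iff_mem_nhds.2 (hnhds _ _ (hzZ true) (hz true n₀ (le_max_left _ _)))⟩
    ⟨_, hzZ false,
      mem_interior_iff_mem_nhds.2 (hnhds _ _ (hzZ false) (hz false n₀ (le_max_right _ _)))⟩
  obtain ⟨w, -, hw1, hw2⟩ := key
  exact Bool.noConfusion (recolour_colour_eq hP (interior_subset hw1) (interior_subset hw2))

/-- A function on the strip is a connectivity function if it is continuous off the bottom line and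
every point of the bottom line is surrounded, at arbitrarily fine scales, by rims on which the
values are close to the value at that point. -/
theorem mem_connectivity_of_rims {F : ℝ × unitInterval → ℝ}
    (hF : ∀ z : ℝ × unitInterval, 0 < (z.2 : ℝ) → ContinuousAt F z)
    (hrim : ∀ x, ∀ ε > 0, ∀ N, ∃ n ≥ N, ∀ m, (x, 0) ∈ cell n m →
      ∀ z ∈ rim n m, |F z - F (x, 0)| < ε) :
    F ∈ Connectivity (ℝ × unitInterval) := by
  intro Z hZ
  refine ⟨hZ.nonempty.image _, ?_⟩
  rw [isPreconnected_iff_subset_of_disjoint]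
  intro u v hu hv huv hdisj
  by_contra hcon
  rw [not_or, Set.not_subset, Set.not_subset] at hcon
  obtain ⟨⟨a, haΓ, hau⟩, ⟨b, hbΓ, hbv⟩⟩ := hcon
  set Γ := (fun x => (x, F x)) '' Z
  -- Make the separating open sets disjoint outside the graph, too.
  have hsep : SeparatedNhds (Γ ∩ u) (Γ ∩ v) := by
    rw [separatedNhds_iff_disjoint]
    apply completely_normal
    · refine Disjoint.mono_right Set.inter_subset_right ?_
      refine Disjoint.closure_left ?_ hv
      rw [Set.disjoint_left]
      rintro x ⟨h1, h2⟩ h3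
      exact hdisj.le ⟨h1, h2, h3⟩
    · refine Disjoint.mono_left Set.inter_subset_right ?_
      refine Disjoint.closure_right ?_ hu
      rw [Set.disjoint_left]
      rintro x h3 ⟨h1, h2⟩
      exact hdisj.le ⟨h1, h3, h2⟩
  obtain ⟨u', v', hu', hv', huu', hvv', hd⟩ := hsep
  let O : Bool → Set ((ℝ × unitInterval) × ℝ) := fun s => bif s then u' else v'
  have hO : ∀ s, IsOpen (O s) := fun s => by cases s <;> assumption
  let P : Bool → Set (ℝ × unitInterval) := fun s => {z | (z, F z) ∈ O s}
  have hcov : ∀ z ∈ Z, ∃ s, z ∈ P s := fun z hz => by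
    have hzΓ : (z, F z) ∈ Γ := ⟨z, hz, rfl⟩
    rcases huv hzΓ with h | h
    · exact ⟨true, huu' ⟨hzΓ, h⟩⟩
    · exact ⟨false, hvv' ⟨hzΓ, h⟩⟩
  refine not_two_coloured (P := P) hZ.isPreconnected ?_ ?_ ?_ hcov ?_
  · intro s s' z hz hz'
    rw [Set.disjoint_left] at hd
    cases s <;> cases s' <;> first | rfl | exact absurd hz' (hd hz) | exact absurd hz (hd hz')
  · intro s z hpos hz
    exact (continuousAt_id.prodMk (hF z hpos)).preimage_mem_nhds ((hO s).mem_nhds hz)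
  · intro s x hxZ hxP N
    obtain ⟨ε, hε, hball⟩ := Metric.isOpen_iff.1 (hO s) _ hxP
    obtain ⟨N', hN'⟩ := exists_nat_one_div_lt hε
    obtain ⟨n, hn, h⟩ := hrim x ε hε (max N N')
    refine ⟨n, (le_max_left _ _).trans hn, fun m hxm z hz => hball ?_⟩
    have hn1 : (1 : ℝ) / (n + 1) < ε :=
      (height_antitone ((le_max_right _ _).trans hn)).trans_lt hN'
    rw [Metric.mem_ball, Prod.dist_eq, max_lt_iff, Prod.dist_eq, max_lt_iff, Real.dist_eq,
      Subtype.dist_eq, Real.dist_eq]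
    refine ⟨⟨?_, ?_⟩, h m hxm z hz⟩
    · refine lt_of_le_of_lt ?_ hn1
      rw [le_div_iff₀ (by positivity)]
      have h1 := abs_sub_le_one_of_mem_cell hz.1 hxm
      nlinarith [add_one_le_scale n, abs_nonneg (z.1 - x)]
    · simp only [Set.Icc.coe_zero, sub_zero, abs_of_nonneg z.2.2.1]
      exact hz.1.2.2.trans_lt hn1
  · intro s
    cases s
    · obtain ⟨z, hz, rfl⟩ := haΓ
      exact ⟨z, hz, hvv' ⟨⟨z, hz, rfl⟩, (huv ⟨z, hz, rfl⟩).resolve_left hau⟩⟩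
    · obtain ⟨z, hz, rfl⟩ := hbΓ
      exact ⟨z, hz, huu' ⟨⟨z, hz, rfl⟩, (huv ⟨z, hz, rfl⟩).resolve_right hbv⟩⟩

/-! ### Extendability -/

/-- The weight of the oscillation of scale `k` at height `y`: it is `0` for `y ≥ 1 / (k + 1)` and
`1` for `0 < y ≤ 1 / (k + 2)`. -/
noncomputable def ramp (k : ℕ) (y : ℝ) : ℝ := max 0 (min 1 (1 / y - 1 - k))

/-- The phase at a point of the strip, interpolating between the partial phases. -/
noncomputable def stripPhase (z : ℝ × unitInterval) : ℝ := ∑' k, osc k z.1 * ramp k z.2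

theorem ramp_eq_zero {n k : ℕ} (h : n ≤ k) {y : ℝ} (hy : 1 / ((n : ℝ) + 1) ≤ y) :
    ramp k y = 0 := by
  have h0 : (0 : ℝ) < 1 / ((n : ℝ) + 1) := by positivity
  have h1 : 1 / y ≤ n + 1 := by
    simpa using one_div_le_one_div_of_le h0 hy
  have h2 : (n : ℝ) ≤ k := by exact_mod_cast h
  exact max_eq_left ((min_le_right _ _).trans (by linarith))

theorem ramp_eq_one {n k : ℕ} (h : k < n) {y : ℝ} (hy0 : 0 < y) (hy : y ≤ 1 / ((n : ℝ) + 1)) :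
    ramp k y = 1 := by
  have h1 : (n : ℝ) + 1 ≤ 1 / y := by
    simpa using one_div_le_one_div_of_le hy0 hy
  have h2 : (k : ℝ) + 1 ≤ n := by exact_mod_cast h
  rw [ramp, min_eq_left (by linarith), max_eq_right zero_le_one]

theorem continuousAt_stripPhase {z : ℝ × unitInterval} (hz : 0 < (z.2 : ℝ)) :
    ContinuousAt stripPhase z := by
  obtain ⟨N, hN⟩ := exists_nat_one_div_lt hz
  have hc2 : Continuous fun w : ℝ × unitInterval => (w.2 : ℝ) :=
    continuous_subtype_val.comp continuous_snd
  have heq : stripPhase =ᶠ[𝓝 z] fun w => ∑ k ∈ Finset.range N, osc k w.1 * ramp k w.2 := by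
    filter_upwards [hc2.continuousAt.eventually (lt_mem_nhds hN)] with w hw
    exact tsum_eq_sum fun k hk => by
      rw [ramp_eq_zero (by simpa using hk) hw.le, mul_zero]
  refine ContinuousAt.congr ?_ heq.symm
  refine tendsto_finsetSum _ fun k _ => ?_
  refine ((continuous_osc k).comp continuous_fst).continuousAt.mul ?_
  have h1 : ContinuousAt (fun w : ℝ × unitInterval => 1 / (w.2 : ℝ) - 1 - k) z :=
    ((continuousAt_const.div hc2.continuousAt hz.ne').sub continuousAt_const).sub continuousAt_const
  exact continuousAt_const.max (continuousAt_const.min h1)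

theorem stripPhase_eq_partialPhase {n : ℕ} {m : ℤ} {z : ℝ × unitInterval} (hz : z ∈ rim n m)
    (hpos : 0 < (z.2 : ℝ)) : stripPhase z = partialPhase n z.1 := by
  have h0 : ∀ k, n ≤ k → osc k z.1 * ramp k z.2 = 0 := fun k hk => by
    rcases hz.2 with h | h | h
    · rw [osc_eq_zero hk h, zero_mul]
    · rw [osc_eq_zero (m := m + 1) hk (by rw [h]; push_cast; ring), zero_mul]
    · rw [ramp_eq_zero hk h.ge, mul_zero]
  rw [stripPhase, tsum_eq_sum (s := Finset.range n) fun k hk => h0 k (by simpa using hk)]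
  refine Finset.sum_congr rfl fun k hk => ?_
  rw [ramp_eq_one (Finset.mem_range.1 hk) hpos hz.1.2.2, mul_one]

theorem exists_grid_of_mem_rim {n : ℕ} {m : ℤ} {z : ℝ × unitInterval} (hz : z ∈ rim n m)
    (h0 : (z.2 : ℝ) = 0) : ∃ k : ℤ, scale n * z.1 = k := by
  rcases hz.2 with h | h | h
  · exact ⟨m, h⟩
  · exact ⟨m + 1, by rw [h]; push_cast; ring⟩
  · have : (0 : ℝ) < 1 / ((n : ℝ) + 1) := by positivity
    linarith

section Prescribed

variable {S f : ℝ → ℝ}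

/-- Every function that is `S ∘ phase` on the points of finite phase is extendable. -/
theorem mem_extendable (hS : IsSweeping S) (hf : ∀ x ∈ finitePhase, f x = S (phase x)) :
    f ∈ Extendable ℝ := by
  classical
  let F : ℝ × unitInterval → ℝ := fun z => if (z.2 : ℝ) = 0 then f z.1 else S (stripPhase z)
  have hF0 : ∀ x, F (x, 0) = f x := fun x => if_pos rfl
  refine ⟨F, mem_connectivity_of_rims (fun z hz => ?_) (fun x ε hε N => ?_), fun x => (hF0 x).symm⟩
  · have hc2 : Continuous fun w : ℝ × unitInterval => (w.2 : ℝ) :=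
      continuous_subtype_val.comp continuous_snd
    refine (hS.continuous.continuousAt.comp (continuousAt_stripPhase hz)).congr ?_
    filter_upwards [hc2.continuousAt.eventually (lt_mem_nhds hz)] with w hw
    exact (if_neg hw.ne').symm
  · obtain ⟨n, hn, h⟩ := exists_scale_near hS hf x hε N
    refine ⟨n, hn, fun m hxm z hz => ?_⟩
    have hFz : F z = S (partialPhase n z.1) := by
      by_cases h0 : (z.2 : ℝ) = 0
      · obtain ⟨k, hk⟩ := exists_grid_of_mem_rim hz h0
        rw [show F z = f z.1 from if_pos h0, hf _ (mem_finitePhase_of_grid hk),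
          phase_eq_partialPhase hk]
      · rw [show F z = S (stripPhase z) from if_neg h0,
          stripPhase_eq_partialPhase hz (lt_of_le_of_ne z.2.2.1 (Ne.symm h0))]
    rw [hFz, hF0]
    exact h _ (abs_sub_le_one_of_mem_cell hz.1 hxm)

/-! ### Almost continuity -/

/-- Over `[a, b]`, the graph of some continuous function runs within `G` from the point of the
graph of `f` over `a` to the one over `b`. -/
def HasLink (f : ℝ → ℝ) (G : Set (ℝ × ℝ)) (a b : ℝ) : Prop :=
  ∃ g : ℝ → ℝ, Continuous g ∧ g a = f a ∧ g b = f b ∧ ∀ x ∈ Set.Icc a b, (x, g x) ∈ G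

theorem HasLink.trans {G : Set (ℝ × ℝ)} {a b c : ℝ} (hab : a ≤ b) (hbc : b ≤ c)
    (h₁ : HasLink f G a b) (h₂ : HasLink f G b c) : HasLink f G a c := by
  obtain ⟨g₁, hg₁, ha, hb, hG₁⟩ := h₁
  obtain ⟨g₂, hg₂, hb', hc, hG₂⟩ := h₂
  refine ⟨fun x => if x ≤ b then g₁ x else g₂ x, ?_, ?_, ?_, fun x hx => ?_⟩
  · refine hg₁.if_le hg₂ continuous_id continuous_const fun x hx => ?_
    subst hx
    exact hb.trans hb'.symm
  · simp only [if_pos hab, ha]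
  · rcases hbc.eq_or_lt with rfl | h
    · simp only [le_refl, if_true, hb]
    · simp only [if_neg (not_le.2 h), hc]
  · by_cases h : x ≤ b
    · simp only [if_pos h]; exact hG₁ x ⟨hx.1, h⟩
    · simp only [if_neg h]; exact hG₂ x ⟨(not_le.1 h).le, hx.2⟩

/-- The left end of a grid interval. -/
noncomputable def gridPoint (n : ℕ) (m : ℤ) : ℝ := m / scale n

theorem scale_mul_gridPoint (n : ℕ) (m : ℤ) : scale n * gridPoint n m = m :=
  mul_div_cancel₀ _ (scale_ne_zero n)

theorem gridPoint_mono (n : ℕ) {m m' : ℤ} (h : m ≤ m') : gridPoint n m ≤ gridPoint n m' :=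
  div_le_div_of_nonneg_right (by exact_mod_cast h) (scale_pos n).le

/-- If a grid interval has no link, then some interval of the next scale within it has none. -/
theorem exists_not_hasLink {G : Set (ℝ × ℝ)} {n : ℕ} {m : ℤ}
    (h : ¬ HasLink f G (gridPoint n m) (gridPoint n (m + 1))) :
    ∃ m' : ℤ, gridPoint n m ≤ gridPoint (n + 1) m' ∧
      gridPoint (n + 1) (m' + 1) ≤ gridPoint n (m + 1) ∧
      ¬ HasLink f G (gridPoint (n + 1) m') (gridPoint (n + 1) (m' + 1)) := by
  by_contra hcon
  push Not at hcon
  obtain ⟨d, hd, hs⟩ := exists_scale_eq_mul n.le_succ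
  have hd0 : (d : ℝ) ≠ 0 := by exact_mod_cast hd.ne'
  have e : ∀ k : ℤ, gridPoint n k = gridPoint (n + 1) (k * d) := fun k => by
    rw [gridPoint, gridPoint, hs, Int.cast_mul, mul_div_mul_right _ _ hd0]
  simp only [e] at h hcon
  have key : ∀ j : ℕ, (j : ℤ) + 1 ≤ d →
      HasLink f G (gridPoint (n + 1) (m * d)) (gridPoint (n + 1) (m * d + (j + 1))) := by
    intro j
    induction j with
    | zero =>
      intro hj
      simp only [Nat.cast_zero, zero_add] at hj ⊢
      exact hcon _ le_rfl (gridPoint_mono _ (by linarith [add_mul m 1 d]))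
    | succ j ih =>
      intro hj
      push_cast at hj ⊢
      refine (ih (by omega)).trans (gridPoint_mono _ (by omega)) (gridPoint_mono _ (by omega)) ?_
      have := hcon (m * d + (j + 1)) (gridPoint_mono _ (by omega))
        (gridPoint_mono _ (by linarith [add_mul m 1 d]))
      rwa [add_assoc] at this
  obtain ⟨j, hj⟩ := Int.eq_ofNat_of_zero_le (by omega : 0 ≤ d - 1)
  have := key j (by omega)
  rw [show m * d + ((j : ℤ) + 1) = (m + 1) * d by rw [← hj]; ring] at this
  exact h this

/-- A grid interval of suitable scale at `x`, on whose ends the values of `f` are close to `f x`,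
has a linear link. -/
theorem exists_scale_hasLink (hS : IsSweeping S) (hf : ∀ x ∈ finitePhase, f x = S (phase x))
    {G : Set (ℝ × ℝ)} (hG : IsOpen G) {x : ℝ} (hx : (x, f x) ∈ G) (N : ℕ) :
    ∃ n ≥ N, ∀ m, x ∈ Set.Icc (gridPoint n m) (gridPoint n (m + 1)) →
      HasLink f G (gridPoint n m) (gridPoint n (m + 1)) := by
  obtain ⟨ε, hε, hball⟩ := Metric.isOpen_iff.1 hG _ hx
  obtain ⟨N', hN'⟩ := exists_nat_one_div_lt hε
  obtain ⟨n, hn, h⟩ := exists_scale_near hS hf x hε (max N N')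
  refine ⟨n, (le_max_left _ _).trans hn, fun m hxm => ?_⟩
  have hs := scale_pos n
  have hm := scale_mul_gridPoint n m
  have hm' := scale_mul_gridPoint n (m + 1)
  push_cast at hm'
  have hdist : ∀ y ∈ Set.Icc (gridPoint n m) (gridPoint n (m + 1)), scale n * |y - x| ≤ 1 := by
    intro y hy
    rw [← abs_of_pos hs, ← abs_mul, mul_sub, abs_le]
    have h1 := mul_le_mul_of_nonneg_left hy.1 hs.le
    have h2 := mul_le_mul_of_nonneg_left hy.2 hs.le
    have h3 := mul_le_mul_of_nonneg_left hxm.1 hs.le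
    have h4 := mul_le_mul_of_nonneg_left hxm.2 hs.le
    constructor <;> linarith
  have hval : ∀ k : ℤ, gridPoint n k ∈ Set.Icc (gridPoint n m) (gridPoint n (m + 1)) →
      f (gridPoint n k) ∈ Metric.ball (f x) ε := fun k hk => by
    have hk' := scale_mul_gridPoint n k
    rw [hf _ (mem_finitePhase_of_grid hk'), phase_eq_partialPhase hk', Metric.mem_ball,
      Real.dist_eq]
    exact h _ (hdist _ hk)
  set a := gridPoint n m
  set b := gridPoint n (m + 1)
  have hab : a < b := by
    refine lt_of_mul_lt_mul_left ?_ hs.le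
    linarith
  have hva := hval m ⟨le_rfl, hab.le⟩
  have hvb := hval (m + 1) ⟨hab.le, le_rfl⟩
  refine ⟨fun y => AffineMap.lineMap (f a) (f b) ((y - a) / (b - a)), ?_, ?_, ?_, fun y hy => ?_⟩
  · exact AffineMap.lineMap_continuous.comp ((continuous_id.sub continuous_const).div_const _)
  · simp
  · simp [div_self (sub_ne_zero.2 hab.ne')]
  · apply hball
    rw [Metric.mem_ball, Prod.dist_eq, max_lt_iff, Real.dist_eq]
    constructor
    · have h1 : (N' : ℝ) ≤ n := by exact_mod_cast (le_max_right _ _).trans hn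
      refine lt_of_le_of_lt ?_ hN'
      rw [le_div_iff₀ (by positivity)]
      nlinarith [hdist y hy, add_one_le_scale n, abs_nonneg (y - x)]
    · refine (convex_ball (f x) ε).lineMap_mem hva hvb ⟨?_, ?_⟩
      · exact div_nonneg (sub_nonneg.2 hy.1) (sub_nonneg.2 hab.le)
      · exact (div_le_one (sub_pos.2 hab)).2 (by linarith [hy.2])

/-- All grid intervals have links: otherwise bisection yields a point at which links fail at all
fine scales. -/
theorem hasLink_gridPoint (hS : IsSweeping S) (hf : ∀ x ∈ finitePhase, f x = S (phase x))
    {G : Set (ℝ × ℝ)} (hG : IsOpen G) (hfG : ∀ x, (x, f x) ∈ G) (m : ℤ) :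
    HasLink f G (gridPoint 0 m) (gridPoint 0 (m + 1)) := by
  by_contra hcon
  choose! next h₁ h₂ h₃ using fun (n : ℕ) (m : ℤ) => exists_not_hasLink (f := f) (G := G)
    (n := n) (m := m)
  let u : ℕ → ℤ := fun n => Nat.rec m next n
  have hu : ∀ n, ¬ HasLink f G (gridPoint n (u n)) (gridPoint n (u n + 1)) := by
    intro n
    induction n with
    | zero => exact hcon
    | succ n ih => exact h₃ n _ ih
  have hanti : Antitone fun n => Set.Icc (gridPoint n (u n)) (gridPoint n (u n + 1)) :=
    antitone_nat_of_succ_le fun n => Set.Icc_subset_Icc (h₁ n _ (hu n)) (h₂ n _ (hu n))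
  have hmem := ciSup_mem_iInter_Icc_of_antitone_Icc hanti
    fun n => gridPoint_mono n (by omega : u n ≤ u n + 1)
  set x := ⨆ n, gridPoint n (u n)
  obtain ⟨n, -, hn⟩ := exists_scale_hasLink hS hf hG (hfG x) 0
  exact hu n (hn _ (Set.mem_iInter.1 hmem n))

/-- Every function that is `S ∘ phase` on the points of finite phase is almost continuous. -/
theorem mem_almostContinuous (hS : IsSweeping S) (hf : ∀ x ∈ finitePhase, f x = S (phase x)) :
    f ∈ AlmostContinuous ℝ := by
  intro G hG hfG
  have hgrid : ∀ k : ℤ, gridPoint 0 k = k := fun k => by simp [gridPoint, scale]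
  have hlink := hasLink_gridPoint hS hf hG hfG
  simp only [hgrid] at hlink
  push_cast at hlink
  choose g hgc hga hgb hgG using hlink
  refine ⟨fun x => g ⌊x⌋ x, continuous_iff_continuousAt.2 fun x => ?_, fun x =>
    hgG _ x ⟨Int.floor_le x, (Int.lt_floor_add_one x).le⟩⟩
  set m := ⌊x⌋
  have hglue : Continuous fun y : ℝ => if (m : ℝ) ≤ y then g m y else g (m - 1) y := by
    refine (hgc m).if_le (hgc (m - 1)) continuous_const continuous_id fun y hy => ?_
    subst hy
    rw [hga]
    have := hgb (m - 1)
    push_cast at this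
    rw [sub_add_cancel] at this
    exact this.symm
  refine hglue.continuousAt.congr ?_
  filter_upwards [gt_mem_nhds (Int.lt_floor_add_one x),
    lt_mem_nhds ((sub_one_lt (m : ℝ)).trans_le (Int.floor_le x))] with y h1 h2
  by_cases h : (m : ℝ) ≤ y
  · rw [if_pos h, show ⌊y⌋ = m from Int.floor_eq_iff.2 ⟨h, h1⟩]
  · rw [if_neg h, show ⌊y⌋ = m - 1 from Int.floor_eq_iff.2
      ⟨by push_cast; exact h2.le, by push_cast; linarith⟩]

end Prescribed

/-! ### Inclusions between the classes -/

theorem extendable_subset_connectivity (X : Type*) [TopologicalSpace X] :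
    Extendable X ⊆ Connectivity X := by
  rintro f ⟨F, hF, hf⟩ Z hZ
  have h1 := hF _ (hZ.image (fun x => (x, (0 : unitInterval))) (by fun_prop))
  have h2 := h1.image (fun p : (X × unitInterval) × ℝ => (p.1.1, p.2)) (by fun_prop)
  rw [Set.image_image, Set.image_image] at h2
  simpa only [← hf] using h2

theorem connectivity_subset_darboux (X : Type*) [TopologicalSpace X] :
    Connectivity X ⊆ Darboux X := by
  intro f hf Z hZ
  have h := (hf Z hZ).image Prod.snd continuous_snd.continuousOn
  rwa [Set.image_image] at h

theorem Darboux.uIcc_subset_image {f : ℝ → ℝ} (hf : f ∈ Darboux ℝ) (x y : ℝ) :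
    Set.uIcc (f x) (f y) ⊆ f '' Set.uIcc x y :=
  have h := hf (Set.uIcc x y) ⟨Set.nonempty_uIcc, isPreconnected_uIcc⟩
  h.isPreconnected.ordConnected.uIcc_subset ⟨x, Set.left_mem_uIcc, rfl⟩ ⟨y, Set.right_mem_uIcc, rfl⟩

/-- A Darboux function takes values close to `f x` on each side of `x`. -/
theorem Darboux.exists_near {f : ℝ → ℝ} (hf : f ∈ Darboux ℝ) {x y : ℝ} (hxy : y ≠ x) {ε : ℝ}
    (hε : 0 < ε) : ∃ u ∈ Set.uIcc x y, u ≠ x ∧ |f u - f x| < ε := by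
  by_cases h : |f y - f x| < ε
  · exact ⟨y, Set.right_mem_uIcc, hxy, h⟩
  obtain ⟨v, hv, hvx, hvε⟩ : ∃ v ∈ Set.uIcc (f x) (f y), v ≠ f x ∧ |v - f x| < ε := by
    rcases le_abs.1 (not_lt.1 h) with h' | h'
    · exact ⟨f x + ε / 2, Set.mem_uIcc.2 (Or.inl ⟨by linarith, by linarith⟩), by linarith,
        abs_lt.2 ⟨by linarith, by linarith⟩⟩
    · exact ⟨f x - ε / 2, Set.mem_uIcc.2 (Or.inr ⟨by linarith, by linarith⟩), by linarith,
        abs_lt.2 ⟨by linarith, by linarith⟩⟩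
  obtain ⟨u, hu, rfl⟩ := Darboux.uIcc_subset_image hf x y hv
  exact ⟨u, hu, fun h => hvx (h ▸ rfl), hvε⟩

theorem darboux_subset_peripherallyContinuous : Darboux ℝ ⊆ PeripherallyContinuous ℝ := by
  intro f hf x U V hU hxU hV hxV
  obtain ⟨δ, hδ, hU'⟩ := Metric.isOpen_iff.1 hU x hxU
  obtain ⟨ε, hε, hV'⟩ := Metric.isOpen_iff.1 hV _ hxV
  obtain ⟨a, ha, hax, haε⟩ := Darboux.exists_near hf (y := x - δ / 2) (x := x) (by linarith) hε
  obtain ⟨b, hb, hbx, hbε⟩ := Darboux.exists_near hf (y := x + δ / 2) (x := x) (by linarith) hε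
  rw [Set.uIcc_of_ge (by linarith)] at ha
  rw [Set.uIcc_of_le (by linarith)] at hb
  have ha' : a < x := lt_of_le_of_ne ha.2 hax
  have hb' : x < b := lt_of_le_of_ne hb.1 hbx.symm
  refine ⟨Set.Ioo a b, isOpen_Ioo, fun y hy => hU' ?_, ⟨ha', hb'⟩, ?_⟩
  · rw [Metric.mem_ball, Real.dist_eq, abs_lt]
    constructor <;> linarith [hy.1, hy.2, ha.1, hb.2]
  · rw [frontier_Ioo (ha'.trans hb'), Set.image_pair, Set.insert_subset_iff,
      Set.singleton_subset_iff]
    exact ⟨hV' haε, hV' hbε⟩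

theorem scivp_subset_civp : SCIVP ⊆ CIVP := fun _ hf x y K hK hxy =>
  let ⟨C, hC, hCxy, hCK, _⟩ := hf x y K hK hxy
  ⟨C, hC, hCxy, hCK⟩

theorem isPerfectSet_Icc {a b : ℝ} (h : a < b) : IsPerfectSet (Set.Icc a b) :=
  ⟨Set.nonempty_Icc.2 h.le, isClosed_Icc,
    isPreconnected_Icc.preperfect_of_nontrivial
      (Set.nontrivial_of_exists_ne (Set.left_mem_Icc.2 h.le) ⟨b, Set.right_mem_Icc.2 h.le, h.ne'⟩)⟩

theorem civp_subset_wcivp : CIVP ⊆ WCIVP := by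
  intro f hf x y hxy
  obtain ⟨C, hC, hCxy, hCK⟩ := hf x y (Set.Icc ((2 * f x + f y) / 3) ((f x + 2 * f y) / 3))
    (isPerfectSet_Icc (by linarith)) (by
      rw [Between, min_eq_left hxy.le, max_eq_right hxy.le]
      intro z hz
      constructor <;> linarith [hz.1, hz.2])
  refine ⟨C, hC, hCxy, hCK.trans fun z hz => ?_⟩
  constructor <;> linarith [hz.1, hz.2]

/-- On each side of `x` there is a perfect set with values close to `f x`: either `f` is constant
there, or the Cantor intermediate value property applies to values close to `f x`. -/
theorem CIVP.exists_perfect_near {f : ℝ → ℝ} (hf : f ∈ CIVP) {x y : ℝ} (hxy : x ≠ y) {ε : ℝ}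
    (hε : 0 < ε) : ∃ C, IsPerfectSet C ∧ Between C x y ∧ ∀ c ∈ C, |f c - f x| < ε := by
  by_cases hconst : ∀ z ∈ Set.Ioo (min x y) (max x y), f z = f x
  · have hlt : min x y < max x y := min_lt_max.2 hxy
    obtain ⟨a, ha, ha'⟩ := exists_between hlt
    obtain ⟨b, hb, hb'⟩ := exists_between ha'
    have hsub : Set.Icc a b ⊆ Set.Ioo (min x y) (max x y) := Set.Icc_subset_Ioo ha hb'
    exact ⟨Set.Icc a b, isPerfectSet_Icc hb, hsub, fun c hc => by simpa [hconst c (hsub hc)]⟩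
  · push Not at hconst
    obtain ⟨z, hz, hne⟩ := hconst
    -- a perfect set of values between `f x` and `f z`, close to `f x`
    obtain ⟨K, hK, hKb, hKε⟩ : ∃ K, IsPerfectSet K ∧ Between K (f x) (f z) ∧
        ∀ k ∈ K, |k - f x| < ε := by
      rcases lt_or_gt_of_ne hne with h | h
      · have h1 : 0 < min (f x - f z) ε := lt_min (by linarith) hε
        have h2 := min_le_left (f x - f z) ε
        have h3 := min_le_right (f x - f z) ε
        set e := min (f x - f z) ε
        refine ⟨Set.Icc (f x - e / 2) (f x - e / 3), isPerfectSet_Icc (by linarith), ?_, ?_⟩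
        · rw [Between, min_eq_right h.le, max_eq_left h.le]
          exact Set.Icc_subset_Ioo (by linarith) (by linarith)
        · intro k hk
          rw [abs_lt]
          constructor <;> linarith [hk.1, hk.2]
      · have h1 : 0 < min (f z - f x) ε := lt_min (by linarith) hε
        have h2 := min_le_left (f z - f x) ε
        have h3 := min_le_right (f z - f x) ε
        set e := min (f z - f x) ε
        refine ⟨Set.Icc (f x + e / 3) (f x + e / 2), isPerfectSet_Icc (by linarith), ?_, ?_⟩
        · rw [Between, min_eq_left h.le, max_eq_right h.le]
          exact Set.Icc_subset_Ioo (by linarith) (by linarith)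
        · intro k hk
          rw [abs_lt]
          constructor <;> linarith [hk.1, hk.2]
    obtain ⟨C, hC, hCb, hCK⟩ := hf x z K hK hKb
    exact ⟨C, hC, hCb.trans (Set.Ioo_subset_Ioo (le_min (min_le_left _ _) hz.1.le)
      (max_le (le_max_left _ _) hz.2.le)), fun c hc => hKε _ (hCK ⟨c, hc, rfl⟩)⟩

theorem civp_subset_perfectRoads : CIVP ⊆ PerfectRoads := by
  intro f hf x
  have hpos : ∀ n : ℕ, (0 : ℝ) < 1 / ((n : ℝ) + 1) := fun n => by positivity
  choose C hC hCb hCf using fun n : ℕ => CIVP.exists_perfect_near hf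
    (x := x) (y := x + 1 / ((n : ℝ) + 1)) (by linarith [hpos n]) (hpos n)
  choose D hD hDb hDf using fun n : ℕ => CIVP.exists_perfect_near hf
    (x := x) (y := x - 1 / ((n : ℝ) + 1)) (by linarith [hpos n]) (hpos n)
  have hCx : ∀ n, ∀ c ∈ C n, x < c ∧ c < x + 1 / ((n : ℝ) + 1) := fun n c hc => by
    have := hCb n hc
    rwa [min_eq_left (by linarith [hpos n]), max_eq_right (by linarith [hpos n])] at this
  have hDx : ∀ n, ∀ c ∈ D n, x - 1 / ((n : ℝ) + 1) < c ∧ c < x := fun n c hc => by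
    have := hDb n hc
    rwa [min_eq_right (by linarith [hpos n]), max_eq_left (by linarith [hpos n])] at this
  let E : ℕ → Set ℝ := fun n => C n ∪ D n
  have hEclosed : ∀ n, IsClosed (E n) := fun n => (hC n).2.closed.union (hD n).2.closed
  have hEx : ∀ n, ∀ c ∈ E n, c ≠ x ∧ |c - x| < 1 / ((n : ℝ) + 1) ∧
      |f c - f x| < 1 / ((n : ℝ) + 1) := by
    rintro n c (hc | hc)
    · have := hCx n c hc
      exact ⟨this.1.ne', abs_lt.2 ⟨by linarith [hpos n], by linarith⟩, hCf n c hc⟩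
    · have := hDx n c hc
      exact ⟨this.2.ne, abs_lt.2 ⟨by linarith, by linarith [hpos n]⟩, hDf n c hc⟩
  have hpre : Preperfect (⋃ n, E n) := by
    intro c hc
    obtain ⟨n, hn⟩ := Set.mem_iUnion.1 hc
    have : AccPt c (𝓟 (E n)) := by
      rcases hn with h | h
      · exact ((hC n).2.acc c h).mono (principal_mono.2 Set.subset_union_left)
      · exact ((hD n).2.acc c h).mono (principal_mono.2 Set.subset_union_right)
    exact this.mono (principal_mono.2 (Set.subset_iUnion E n))
  refine ⟨closure (⋃ n, E n), ⟨?_, hpre.perfect_closure⟩, ?_, ?_, ?_⟩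
  · obtain ⟨c, hc⟩ := (hC 0).1
    exact ⟨c, subset_closure (Set.mem_iUnion.2 ⟨0, Or.inl hc⟩)⟩
  · rw [Metric.mem_closure_iff]
    intro ε hε
    obtain ⟨n, hn⟩ := exists_nat_one_div_lt hε
    obtain ⟨c, hc⟩ := (hD n).1
    refine ⟨c, ⟨subset_closure (Set.mem_iUnion.2 ⟨n, Or.inr hc⟩), (hDx n c hc).2⟩, ?_⟩
    rw [dist_comm, Real.dist_eq]
    exact (hEx n c (Or.inr hc)).2.1.trans hn
  · rw [Metric.mem_closure_iff]
    intro ε hε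
    obtain ⟨n, hn⟩ := exists_nat_one_div_lt hε
    obtain ⟨c, hc⟩ := (hC n).1
    refine ⟨c, ⟨subset_closure (Set.mem_iUnion.2 ⟨n, Or.inl hc⟩), (hCx n c hc).1⟩, ?_⟩
    rw [dist_comm, Real.dist_eq]
    exact (hEx n c (Or.inl hc)).2.1.trans hn
  · rw [Metric.continuousWithinAt_iff']
    intro ε hε
    obtain ⟨N, hN⟩ := exists_nat_one_div_lt hε
    -- Away from the finitely many first sets, all values are close to `f x`.
    have hfin : IsClosed (⋃ n ∈ Finset.range N, E n) :=
      isClosed_biUnion_finset fun n _ => hEclosed n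
    have hnear : ∀ᶠ y in 𝓝 x, y ∉ ⋃ n ∈ Finset.range N, E n :=
      hfin.isOpen_compl.mem_nhds fun h => by
        simp only [Set.mem_iUnion] at h
        obtain ⟨n, -, hn⟩ := h
        exact (hEx n x hn).1 rfl
    have hlim : ∀ y ∈ closure (⋃ n, E n), y ≠ x → ∃ n, y ∈ E n := by
      intro y hy hyx
      obtain ⟨M, hM⟩ := exists_nat_one_div_lt (half_pos (abs_pos.2 (sub_ne_zero.2 hyx)))
      have hsub : (⋃ n, E n) ⊆ (⋃ n ∈ Finset.range M, E n) ∪ Metric.closedBall x (|y - x| / 2) := by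
        intro c hc
        obtain ⟨n, hn⟩ := Set.mem_iUnion.1 hc
        by_cases hnM : n < M
        · exact Or.inl (Set.mem_biUnion (Finset.mem_coe.2 (Finset.mem_range.2 hnM)) hn)
        · right
          rw [Metric.mem_closedBall, Real.dist_eq]
          exact ((hEx n c hn).2.1.trans_le (height_antitone (not_lt.1 hnM))).le.trans hM.le
      have hcl : IsClosed ((⋃ n ∈ Finset.range M, E n) ∪ Metric.closedBall x (|y - x| / 2)) :=
        (isClosed_biUnion_finset fun n _ => hEclosed n).union Metric.isClosed_closedBall
      rcases closure_minimal hsub hcl hy with h | h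
      · simp only [Set.mem_iUnion] at h
        obtain ⟨n, -, hn⟩ := h
        exact ⟨n, hn⟩
      · rw [Metric.mem_closedBall, Real.dist_eq] at h
        linarith [abs_pos.2 (sub_ne_zero.2 hyx)]
    filter_upwards [self_mem_nhdsWithin, mem_nhdsWithin_of_mem_nhds hnear] with y hy hyN
    by_cases hyx : y = x
    · rwa [hyx, dist_self]
    obtain ⟨n, hn⟩ := hlim y hy hyx
    have hNn : N ≤ n := by
      by_contra h
      exact hyN (Set.mem_biUnion (Finset.mem_coe.2 (Finset.mem_range.2 (not_le.1 h))) hn)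
    rw [Real.dist_eq]
    exact ((hEx n y hn).2.2.trans_le (height_antitone hNn)).trans hN

theorem Connectivity.comp_homeomorph {X Y : Type*} [TopologicalSpace X] [TopologicalSpace Y]
    {F : Y → ℝ} (hF : F ∈ Connectivity Y) (e : X ≃ₜ Y) : F ∘ e ∈ Connectivity X := by
  intro Z hZ
  have h1 := (hF _ (hZ.image e e.continuous.continuousOn)).image
    (fun p : Y × ℝ => (e.symm p.1, p.2)) (by fun_prop)
  rw [Set.image_image, Set.image_image] at h1
  simpa using h1

theorem Extendable.comp_homeomorph {X Y : Type*} [TopologicalSpace X] [TopologicalSpace Y]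
    {f : Y → ℝ} (hf : f ∈ Extendable Y) (e : X ≃ₜ Y) : f ∘ e ∈ Extendable X := by
  obtain ⟨F, hF, hfF⟩ := hf
  exact ⟨_, Connectivity.comp_homeomorph hF (e.prodCongr (Homeomorph.refl unitInterval)),
    fun x => hfF (e x)⟩

theorem AlmostContinuous.comp_homeomorph {X Y : Type*} [TopologicalSpace X] [TopologicalSpace Y]
    {f : Y → ℝ} (hf : f ∈ AlmostContinuous Y) (e : X ≃ₜ Y) : f ∘ e ∈ AlmostContinuous X := by
  intro G hG hfG
  obtain ⟨g, hg, hgG⟩ := hf ((fun p : Y × ℝ => (e.symm p.1, p.2)) ⁻¹' G)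
    (hG.preimage (by fun_prop)) fun y => by simpa using hfG (e.symm y)
  exact ⟨g ∘ e, hg.comp e.continuous, fun x => by simpa using hgG (e x)⟩

/-! ### The strong Cantor intermediate value property -/

theorem phase_eq_toReal (x : ℝ) : phase x = (∑' k, ENNReal.ofReal (osc k x)).toReal := by
  rw [ENNReal.tsum_toReal_eq fun k => ENNReal.ofReal_ne_top]
  simp only [ENNReal.toReal_ofReal (osc_nonneg _ x), phase]

theorem mem_finitePhase_iff_ne_top {x : ℝ} :
    x ∈ finitePhase ↔ ∑' k, ENNReal.ofReal (osc k x) ≠ ⊤ := by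
  refine ⟨fun h => (mem_finitePhase.1 h).tsum_ofReal_ne_top, fun h => ?_⟩
  simpa only [mem_finitePhase, ENNReal.toReal_ofReal (osc_nonneg _ x)]
    using ENNReal.summable_toReal h

theorem measurable_tsum_osc : Measurable fun x => ∑' k, ENNReal.ofReal (osc k x) :=
  Measurable.tsum fun k => (continuous_osc k).measurable.ennreal_ofReal

theorem measurable_phase : Measurable phase := by
  rw [show phase = _ from funext phase_eq_toReal]
  exact measurable_tsum_osc.ennreal_toReal

theorem measurableSet_finitePhase : MeasurableSet (finitePhase : Set ℝ) := by
  have : (finitePhase : Set ℝ) = (fun x => ∑' k, ENNReal.ofReal (osc k x)) ⁻¹' {⊤}ᶜ :=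
    Set.ext fun x => mem_finitePhase_iff_ne_top
  rw [this]
  exact measurable_tsum_osc (measurableSet_singleton _).compl

theorem not_countable_range_of_injective {α : Type*} {g : (ℕ → Bool) → α}
    (hg : Function.Injective g) : ¬ (Set.range g).Countable := fun h => by
  have h1 : Countable (Set.range g) := h
  have h2 : Countable (ℕ → Bool) := (Equiv.ofInjective g hg).injective.countable
  have h3 := Cardinal.mk_le_aleph0 (α := ℕ → Bool)
  have h4 := Cardinal.cantor ℵ₀
  simp only [Cardinal.mk_arrow, Cardinal.lift_uzero, Cardinal.mk_bool, Cardinal.mk_nat] at h3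
  exact absurd h3 (not_le.2 (by simpa using h4))

/-- Every uncountable Borel set contains a Cantor set along which a given Borel function is
continuous: for a finer Polish topology the function is continuous and the set is closed. -/
theorem exists_cantor_injection {α : Type*} [t₀ : TopologicalSpace α] [PolishSpace α]
    [MeasurableSpace α] [BorelSpace α] {g : α → ℝ} (hg : Measurable g) {E : Set α}
    (hE : MeasurableSet E) (hunc : ¬ E.Countable) :
    ∃ c : (ℕ → Bool) → α, Set.range c ⊆ E ∧ Continuous c ∧ Continuous (g ∘ c) ∧
      Function.Injective c := by
  have hpair : Measurable fun x => (g x, E.indicator (fun _ => (1 : ℝ)) x) :=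
    hg.prodMk (measurable_const.indicator hE)
  obtain ⟨t, ht, hcont, hpol⟩ := hpair.exists_continuous
  have hclosed : IsClosed[t] E := by
    have : E = (fun x => (g x, E.indicator (fun _ => (1 : ℝ)) x)) ⁻¹' (Prod.snd ⁻¹' {1}) := by
      ext x
      by_cases hx : x ∈ E <;> simp [hx]
    rw [this]
    exact (isClosed_singleton.preimage continuous_snd).preimage hcont
  obtain ⟨c, hcE, hc, hinj⟩ :=
    @IsClosed.exists_nat_bool_injection_of_not_countable α t hpol E hclosed hunc
  exact ⟨c, hcE, continuous_le_rng ht hc, continuous_fst.comp (hcont.comp hc), hinj⟩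

theorem exists_perfect_continuousOn {g : ℝ → ℝ} (hg : Measurable g) {E : Set ℝ}
    (hE : MeasurableSet E) (hunc : ¬ E.Countable) :
    ∃ C ⊆ E, IsPerfectSet C ∧ ContinuousOn g C := by
  obtain ⟨c, hcE, hc, hgc, hinj⟩ := exists_cantor_injection hg hE hunc
  have hemb : IsClosedEmbedding c := hc.isClosedEmbedding hinj
  obtain ⟨C, hC, hCne, hCc⟩ := exists_perfect_nonempty_of_isClosed_of_not_countable
    hemb.isClosed_range (not_countable_range_of_injective hinj)
  refine ⟨C, hCc.trans hcE, ⟨hCne, hC⟩, ContinuousOn.mono ?_ hCc⟩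
  rw [continuousOn_iff_continuous_domRestrict]
  refine (hgc.comp hemb.isEmbedding.toHomeomorph.symm.continuous).congr fun x => ?_
  obtain ⟨y, rfl⟩ := hemb.isEmbedding.toHomeomorph.surjective x
  simp

section Translates

variable {S f : ℝ → ℝ} {t : ℝ}

theorem mem_extendable_of_sub (hS : IsSweeping S)
    (hf : ∀ x, x - t ∈ finitePhase → f x = S (phase (x - t))) : f ∈ Extendable ℝ := by
  have h := Extendable.comp_homeomorph (mem_extendable (f := fun x => f (x + t)) hS
    fun x hx => by rw [hf (x + t) (by rwa [add_sub_cancel_right]), add_sub_cancel_right])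
    (Homeomorph.subRight t)
  simpa [Function.comp_def] using h

theorem mem_almostContinuous_of_sub (hS : IsSweeping S)
    (hf : ∀ x, x - t ∈ finitePhase → f x = S (phase (x - t))) : f ∈ AlmostContinuous ℝ := by
  have h := AlmostContinuous.comp_homeomorph (mem_almostContinuous (f := fun x => f (x + t)) hS
    fun x hx => by rw [hf (x + t) (by rwa [add_sub_cancel_right]), add_sub_cancel_right])
    (Homeomorph.subRight t)
  simpa [Function.comp_def] using h

/-- The values of `f` between `f x` and `f y`, except possibly `0`, are taken at points of finite
phase between `x` and `y`: the function that is `0` off these points, `x` and `y` is Darboux,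
too. -/
theorem exists_eq_of_between (hS : IsSweeping S)
    (hf : ∀ x, x - t ∈ finitePhase → f x = S (phase (x - t))) {x y v : ℝ}
    (hv : v ∈ Set.Ioo (min (f x) (f y)) (max (f x) (f y))) (hv0 : v ≠ 0) :
    ∃ z ∈ Set.Ioo (min x y) (max x y), z - t ∈ finitePhase ∧ S (phase (z - t)) = v := by
  classical
  let f' : ℝ → ℝ := fun z => if z - t ∈ finitePhase ∨ z = x ∨ z = y then f z else 0
  have hf' : f' ∈ Darboux ℝ := connectivity_subset_darboux ℝ (extendable_subset_connectivity ℝ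
    (mem_extendable_of_sub hS fun z hz => (if_pos (Or.inl hz)).trans (hf z hz)))
  have hx : f' x = f x := if_pos (by simp)
  have hy : f' y = f y := if_pos (by simp)
  have hvx : v ≠ f x := by
    rintro rfl
    rcases le_total (f x) (f y) with h | h <;> simp [h] at hv
  have hvy : v ≠ f y := by
    rintro rfl
    rcases le_total (f x) (f y) with h | h <;> simp [h] at hv
  obtain ⟨z, hz, hzv⟩ := Darboux.uIcc_subset_image hf' x y
    (show v ∈ Set.uIcc (f' x) (f' y) by rw [hx, hy]; exact Set.Ioo_subset_Icc_self hv)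
  have hzx : z ≠ x := by rintro rfl; exact hvx (hzv.symm.trans hx)
  have hzy : z ≠ y := by rintro rfl; exact hvy (hzv.symm.trans hy)
  have hzG : z - t ∈ finitePhase := by
    by_contra h
    exact hv0 (hzv.symm.trans (if_neg (by simp [h, hzx, hzy])))
  refine ⟨z, ⟨lt_of_le_of_ne hz.1 ?_, lt_of_le_of_ne hz.2 ?_⟩, hzG, ?_⟩
  · rcases min_choice x y with h | h <;> rw [h] <;> [exact hzx.symm; exact hzy.symm]
  · rcases max_choice x y with h | h <;> rw [h] <;> [exact hzx; exact hzy]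
  · rw [← hf z hzG, ← hzv]
    exact (if_pos (Or.inl hzG)).symm

/-- The preimage of `K` among the points of finite phase between `x` and `y` is an uncountable Borel
set, hence contains a perfect set on which `S ∘ phase` is continuous. -/
theorem mem_scivp_of_sub (hS : IsSweeping S)
    (hf : ∀ x, x - t ∈ finitePhase → f x = S (phase (x - t))) : f ∈ SCIVP := by
  intro x y K hK hKxy
  have hg : Measurable fun z => S (phase (z - t)) :=
    hS.continuous.measurable.comp (measurable_phase.comp (measurable_id.sub_const t))
  set E : Set ℝ := {z | z ∈ Set.Ioo (min x y) (max x y) ∧ z - t ∈ finitePhase ∧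
    S (phase (z - t)) ∈ K}
  have hE : MeasurableSet E :=
    measurableSet_Ioo.inter (((measurable_id.sub_const t) measurableSet_finitePhase).inter
      (hg hK.2.closed.measurableSet))
  have hunc : ¬ E.Countable := fun hc => by
    obtain ⟨c, hcK, -, hinj⟩ := hK.2.exists_nat_bool_injection hK.1
    refine not_countable_range_of_injective hinj
      (((hc.image fun z => S (phase (z - t))).insert 0).mono fun v hv => ?_)
    by_cases hv0 : v = 0
    · exact Or.inl hv0
    · obtain ⟨z, hz, hzG, hzv⟩ := exists_eq_of_between hS hf (hKxy (hcK hv)) hv0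
      exact Or.inr ⟨z, ⟨hz, hzG, hzv ▸ hcK hv⟩, hzv⟩
  obtain ⟨C, hCE, hC, hcont⟩ := exists_perfect_continuousOn hg hE hunc
  refine ⟨C, hC, fun z hz => (hCE hz).1, ?_, hcont.congr fun z hz => hf z (hCE hz).2.1⟩
  rintro _ ⟨z, hz, rfl⟩
  rw [hf z (hCE hz).2.1]
  exact (hCE hz).2.2

end Translates

/-! ### Continuum many cosets -/

/-- Representatives of continuum many cosets of `finitePhase`: every `a m` is repeated at the
infinitely many indices `Nat.pair m j`, where it contributes half a period to the oscillation. -/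
noncomputable def cosetRep (a : ℕ → Bool) : ℝ :=
  ∑' k, ((a k.unpair.1).toNat : ℝ) / (2 * scale k)

theorem scale_mul_two_pow_le {n : ℕ} (hn : 1 ≤ n) (j : ℕ) :
    scale n * (8 * 2 ^ j) ≤ scale (j + (n + 1)) := by
  induction j with
  | zero =>
    have h4 : (4 : ℝ) ^ 1 ≤ 4 ^ n := pow_le_pow_right₀ (by norm_num) hn
    rw [zero_add, scale_succ]
    nlinarith [scale_pos n]
  | succ j ih =>
    have h4 : (1 : ℝ) ≤ 4 ^ (j + (n + 1)) := one_le_pow₀ (by norm_num)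
    rw [show j + 1 + (n + 1) = j + (n + 1) + 1 by ring, scale_succ, pow_succ]
    nlinarith [scale_pos (j + (n + 1))]

theorem norm_digit_div_le {d : ℤ} (hd : |d| ≤ 1) (k : ℕ) :
    ‖(d : ℝ) / (2 * scale k)‖ ≤ 1 / (2 * scale k) := by
  have hk := scale_pos k
  rw [norm_div, Real.norm_eq_abs, Real.norm_eq_abs, abs_of_pos (by positivity : 0 < 2 * scale k)]
  have : |(d : ℝ)| ≤ 1 := by exact_mod_cast hd
  gcongr

theorem summable_digits {d : ℕ → ℤ} (hd : ∀ k, |d k| ≤ 1) :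
    Summable fun k => (d k : ℝ) / (2 * scale k) := by
  refine Summable.of_norm_bounded summable_geometric_two fun k => ?_
  refine (norm_digit_div_le (hd k) k).trans ?_
  rw [one_div_pow]
  have h : (2 : ℝ) ^ k ≤ scale k :=
    pow_le_pow_right₀ (by norm_num) (Nat.le_self_pow two_ne_zero k)
  have := scale_pos k
  gcongr
  linarith

/-- A nonzero digit of scale `n` makes the oscillation of scale `n` large: the earlier digits
contribute integers, and the later ones little. -/
theorem quarter_le_osc {d : ℕ → ℤ} (hd : ∀ k, |d k| ≤ 1) {n : ℕ} (hn : 1 ≤ n) (hdn : d n ≠ 0) :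
    1 / 4 ≤ osc n (∑' k, (d k : ℝ) / (2 * scale k)) := by
  have hs := scale_pos n
  have hsum := summable_digits hd
  rw [← hsum.sum_add_tsum_nat_add (n + 1), Finset.sum_range_succ]
  set r := ∑' j, (d (j + (n + 1)) : ℝ) / (2 * scale (j + (n + 1)))
  have hr : |scale n * r| ≤ 1 / 8 := by
    have h1 : ‖r‖ ≤ (1 / (16 * scale n)) * 2 := by
      refine tsum_of_norm_bounded (hasSum_geometric_two.mul_left _) fun j => ?_
      refine (norm_digit_div_le (hd _) _).trans ?_
      rw [one_div_pow, one_div_mul_one_div]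
      have := scale_mul_two_pow_le hn j
      apply one_div_le_one_div_of_le (by positivity)
      linarith
    rw [abs_mul, abs_of_pos hs]
    rw [Real.norm_eq_abs] at h1
    calc scale n * |r| ≤ scale n * (1 / (16 * scale n) * 2) := by gcongr
      _ = 1 / 8 := by field_simp; norm_num
  obtain ⟨N, hN⟩ : ∃ N : ℤ,
      scale n * ∑ k ∈ Finset.range n, (d k : ℝ) / (2 * scale k) = N := by
    rw [Finset.mul_sum]
    suffices ∀ k ∈ Finset.range n, ∃ N : ℤ, scale n * ((d k : ℝ) / (2 * scale k)) = N by
      choose! N hN using this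
      exact ⟨∑ k ∈ Finset.range n, N k, by push_cast; exact Finset.sum_congr rfl hN⟩
    intro k hk
    obtain ⟨e, -, he⟩ := exists_scale_eq_mul (Nat.succ_le_of_lt (Finset.mem_range.1 hk))
    refine ⟨d k * 4 ^ k * e, ?_⟩
    have := scale_ne_zero k
    rw [he, Nat.succ_eq_add_one, scale_succ]
    push_cast
    field_simp
  have hmid : scale n * ((d n : ℝ) / (2 * scale n)) = d n / 2 := by field_simp
  rw [osc, mul_add, mul_add, hN, hmid, UnitAddCircle.norm_eq]
  set R := round ((N : ℝ) + d n / 2 + scale n * r)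
  by_contra hlt
  rw [not_le, abs_lt] at hlt
  rw [abs_le] at hr
  have h1 : ((2 * N + d n - 2 * R : ℤ) : ℝ) < (1 : ℤ) := by push_cast; linarith
  have h2 : ((-1 : ℤ) : ℝ) < ((2 * N + d n - 2 * R : ℤ) : ℝ) := by push_cast; linarith
  have h1' : 2 * N + d n - 2 * R < 1 := by exact_mod_cast h1
  have h2' : -1 < 2 * N + d n - 2 * R := by exact_mod_cast h2
  have h3 := abs_le.1 (hd n)
  omega

theorem cosetRep_sub_notMem {a b : ℕ → Bool} (h : a ≠ b) :
    cosetRep a - cosetRep b ∉ finitePhase := by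
  intro hmem
  obtain ⟨m, hm⟩ := Function.ne_iff.1 h
  let d : (ℕ → Bool) → ℕ → ℤ := fun a k => (a k.unpair.1).toNat
  have hd1 : ∀ a k, |d a k| ≤ 1 := fun a k => by
    cases hk : a k.unpair.1 <;> simp [d, hk]
  have hd2 : ∀ k, |d a k - d b k| ≤ 1 := fun k => by
    cases hk : a k.unpair.1 <;> cases hk' : b k.unpair.1 <;> simp [d, hk, hk']
  have hsub : cosetRep a - cosetRep b =
      ∑' k, ((d a k - d b k : ℤ) : ℝ) / (2 * scale k) := by
    have := (summable_digits (hd1 a)).tsum_sub (summable_digits (hd1 b))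
    simp only [cosetRep, d, Int.cast_sub, sub_div, Int.cast_natCast] at this ⊢
    exact this.symm
  rw [hsub] at hmem
  obtain ⟨M, hM⟩ := eventually_atTop.1
    ((mem_finitePhase.1 hmem).tendsto_atTop_zero.eventually
      (gt_mem_nhds (by norm_num : (0 : ℝ) < 1 / 4)))
  have hle := Nat.right_le_pair m (M + 1)
  refine absurd (quarter_le_osc hd2 (n := Nat.pair m (M + 1)) (by omega) ?_)
    (not_le.2 (hM _ (by omega)))
  simp only [d, Nat.unpair_pair]
  cases hk : a m <;> cases hk' : b m <;> simp_all

theorem cosetRep_unique {a b : ℕ → Bool} {x : ℝ} (ha : x - cosetRep a ∈ finitePhase)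
    (hb : x - cosetRep b ∈ finitePhase) : a = b := by
  by_contra h
  refine cosetRep_sub_notMem h ?_
  simpa using finitePhase.sub_mem hb ha

/-! ### The closed subspace -/

open Classical in
/-- The function that is `s a` times the translate of `sweep ∘ phase` on the coset of index `a`,
and `0` off these cosets. -/
noncomputable def cosetFun : ((ℕ → Bool) → ℝ) →ₗ[ℝ] (ℝ → ℝ) where
  toFun s x := if h : ∃ a, x - cosetRep a ∈ finitePhase then
    s h.choose * sweep (phase (x - cosetRep h.choose)) else 0
  map_add' s s' := by
    funext x
    by_cases h : ∃ a, x - cosetRep a ∈ finitePhase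
    · simp only [Pi.add_apply, dif_pos h, add_mul]
    · simp only [Pi.add_apply, dif_neg h, add_zero]
  map_smul' c s := by
    funext x
    by_cases h : ∃ a, x - cosetRep a ∈ finitePhase
    · simp only [Pi.smul_apply, dif_pos h, smul_eq_mul, mul_assoc, RingHom.id_apply]
    · simp only [Pi.smul_apply, dif_neg h, smul_zero]

theorem cosetFun_apply (s : (ℕ → Bool) → ℝ) {a : ℕ → Bool} {x : ℝ}
    (ha : x - cosetRep a ∈ finitePhase) :
    cosetFun s x = s a * sweep (phase (x - cosetRep a)) := by
  have h : ∃ a, x - cosetRep a ∈ finitePhase := ⟨a, ha⟩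
  have : h.choose = a := cosetRep_unique h.choose_spec ha
  simp only [cosetFun, LinearMap.coe_mk, AddHom.coe_mk, dif_pos h, this]

theorem cosetFun_cosetRep (s : (ℕ → Bool) → ℝ) (a : ℕ → Bool) :
    cosetFun s (cosetRep a) = s a := by
  have h0 : phase 0 = 0 := by simp [phase, osc]
  rw [cosetFun_apply s (a := a) (by rw [sub_self]; exact finitePhase.zero_mem), sub_self, h0,
    sweep_zero, mul_one]

theorem cosetFun_injective : Function.Injective cosetFun := fun s s' h => funext fun a => by
  rw [← cosetFun_cosetRep s, h, cosetFun_cosetRep]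

theorem isClosed_range_cosetFun : IsClosed (cosetFun.range : Set (ℝ → ℝ)) := by
  have hrange : (cosetFun.range : Set (ℝ → ℝ)) = {f | f = cosetFun (f ∘ cosetRep)} := by
    ext f
    refine ⟨?_, fun h => ⟨_, h.symm⟩⟩
    rintro ⟨s, rfl⟩
    exact congrArg cosetFun (funext fun a => (cosetFun_cosetRep s a).symm)
  rw [hrange]
  refine isClosed_eq continuous_id (continuous_pi fun x => ?_)
  by_cases h : ∃ a, x - cosetRep a ∈ finitePhase
  · obtain ⟨a, ha⟩ := h
    simp only [cosetFun_apply _ ha, Function.comp]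
    fun_prop
  · simp only [cosetFun, LinearMap.coe_mk, AddHom.coe_mk, dif_neg h]
    fun_prop

theorem rank_range_cosetFun : Module.rank ℝ cosetFun.range = 2 ^ 𝔠 := by
  rw [← (LinearEquiv.ofInjective cosetFun cosetFun_injective).rank_eq, rank_fun_infinite]
  simp only [Cardinal.mk_arrow, Cardinal.lift_uzero, Cardinal.mk_bool, Cardinal.mk_nat,
    Cardinal.mk_real]
  rw [Cardinal.two_power_aleph0, Cardinal.power_self_eq Cardinal.aleph0_le_continuum]

/-- The nonzero members of the subspace are, on some coset, nonzero multiples of the translate of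
`sweep ∘ phase`. -/
theorem range_cosetFun_subset {M : Set (ℝ → ℝ)}
    (hM : ∀ (S f : ℝ → ℝ) (t : ℝ), IsSweeping S →
      (∀ x, x - t ∈ finitePhase → f x = S (phase (x - t))) → f ∈ M) :
    (cosetFun.range : Set (ℝ → ℝ)) ⊆ M ∪ {0} := by
  rintro _ ⟨s, rfl⟩
  by_cases hs : s = 0
  · exact Or.inr (by simp [hs])
  · obtain ⟨a, ha⟩ := Function.ne_iff.1 hs
    exact Or.inl (hM _ _ (cosetRep a) (isSweeping_sweep.const_mul ha)
      fun x hx => cosetFun_apply s hx)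

theorem isSpaceable_of_extension {M : Set (ℝ → ℝ)}
    (hM : ∀ (S f : ℝ → ℝ) (t : ℝ), IsSweeping S →
      (∀ x, x - t ∈ finitePhase → f x = S (phase (x - t))) → f ∈ M) :
    IsSpaceable ℝ M (2 ^ 𝔠) :=
  ⟨cosetFun.range, isClosed_range_cosetFun, range_cosetFun_subset hM, rank_range_cosetFun⟩

theorem rank_submodule_le (V : Submodule ℝ (ℝ → ℝ)) : Module.rank ℝ V ≤ 2 ^ 𝔠 := by
  refine V.rank_le.trans ?_
  rw [rank_fun_infinite]
  simp only [Cardinal.mk_arrow, Cardinal.mk_real, Cardinal.lift_id]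
  rw [Cardinal.power_self_eq Cardinal.aleph0_le_continuum]

theorem IsSpaceable.spaceabilityNumber_eq {M : Set (ℝ → ℝ)} (h : IsSpaceable ℝ M (2 ^ 𝔠)) :
    spaceabilityNumber ℝ M = Order.succ (2 ^ 𝔠) := by
  obtain ⟨V, hV, hVM, hrank⟩ := h
  have hmem : Order.succ ((2 : Cardinal) ^ 𝔠) ∈ {κ | ¬ ∃ V : Submodule ℝ (ℝ → ℝ),
      IsClosed (V : Set (ℝ → ℝ)) ∧ (V : Set (ℝ → ℝ)) ⊆ M ∪ {0} ∧ κ ≤ Module.rank ℝ V} := by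
    rintro ⟨V, -, -, hV⟩
    exact absurd (hV.trans (rank_submodule_le V)) (not_le.2 (Order.lt_succ _))
  refine le_antisymm (csInf_le' hmem) (le_csInf ⟨_, hmem⟩ fun κ hκ => Order.succ_le_of_lt ?_)
  by_contra hle
  exact hκ ⟨V, hV, hVM, hrank ▸ not_lt.1 hle⟩

end DarbouxLike


/-- The vector space `ℝ → ℝ` carries the product topology, that is, the topology of pointwise
convergence. -/
theorem mainTheorem3 :
    DarbouxLike.spaceabilityNumber ℝ (DarbouxLike.Extendable ℝ) = Order.succ ((2 : Cardinal) ^ 𝔠) ∧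
    DarbouxLike.IsSpaceable ℝ (DarbouxLike.Extendable ℝ) (2 ^ 𝔠) ∧
    DarbouxLike.IsSpaceable ℝ (DarbouxLike.AlmostContinuous ℝ) (2 ^ 𝔠) ∧
    DarbouxLike.IsSpaceable ℝ (DarbouxLike.Connectivity ℝ) (2 ^ 𝔠) ∧
    DarbouxLike.IsSpaceable ℝ (DarbouxLike.Darboux ℝ) (2 ^ 𝔠) ∧
    DarbouxLike.IsSpaceable ℝ DarbouxLike.SCIVP (2 ^ 𝔠) ∧
    DarbouxLike.IsSpaceable ℝ DarbouxLike.CIVP (2 ^ 𝔠) ∧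
    DarbouxLike.IsSpaceable ℝ DarbouxLike.WCIVP (2 ^ 𝔠) ∧
    DarbouxLike.IsSpaceable ℝ DarbouxLike.PerfectRoads (2 ^ 𝔠) ∧
    DarbouxLike.IsSpaceable ℝ (DarbouxLike.PeripherallyContinuous ℝ) (2 ^ 𝔠) := by
  have mono : ∀ {M M' : Set (ℝ → ℝ)}, M ⊆ M' → DarbouxLike.IsSpaceable ℝ M (2 ^ 𝔠) →
      DarbouxLike.IsSpaceable ℝ M' (2 ^ 𝔠) := fun hMM' ⟨V, hV, hVM, hrank⟩ =>
    ⟨V, hV, hVM.trans (Set.union_subset_union_left _ hMM'), hrank⟩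
  have ext := DarbouxLike.isSpaceable_of_extension
    fun _ _ _ => DarbouxLike.mem_extendable_of_sub
  have conn := mono (DarbouxLike.extendable_subset_connectivity ℝ) ext
  have darb := mono (DarbouxLike.connectivity_subset_darboux ℝ) conn
  have scivp := DarbouxLike.isSpaceable_of_extension
    fun _ _ _ => DarbouxLike.mem_scivp_of_sub
  have civp := mono DarbouxLike.scivp_subset_civp scivp
  exact ⟨ext.spaceabilityNumber_eq, ext,
    DarbouxLike.isSpaceable_of_extension fun _ _ _ => DarbouxLike.mem_almostContinuous_of_sub,
    conn, darb, scivp, civp, mono DarbouxLike.civp_subset_wcivp civp,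
    mono DarbouxLike.civp_subset_perfectRoads civp,
    mono DarbouxLike.darboux_subset_peripherallyContinuous darb⟩
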